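/- Let $\mathbb{D}$ be the open unit disc. For $0<\alpha<1$, $0<p<\infty$ and $f$ analytic in $\mathbb{D}$ put $$M_p^p(r,f)=\int_0^{2\pi}|f(re^{i\theta})|^p\,\frac{d\theta}{2\pi},\qquad \|f\|_{\alpha,p}^p=|f(0)|^p+\int_0^1\Big(\frac{d}{dr}M_p^p(r,f)\Big)(1-r^2)^{\alpha-1}\,dr,$$ and let $A^p_\alpha$ be the class of all analytic $f$ in $\mathbb{D}$ with $\|f\|_{\alpha,p}<\infty$. Let $H^p$ be the Hardy space of all analytic $g$ in $\mathbb{D}$ with $\sup_{0<r<1}M_p^p(r,g)<\infty$. An inner function is an analytic function $I$ in $\mathbb{D}$ with $|I|\le 1$ whose radial limits exist and have modulus $1$ at almost every point of the unit circle; it is nontrivial if it is not constant, and it divides $f$ if $f/I$ belongs to $H^p$ (that is, $f=Ig$ in $\mathbb{D}$ for some $g\in H^p$, denoted $f/I$). An outer function is a function of the form $$F(z)=c\exp\Big(\int_0^{2\pi}\frac{e^{i\theta}+z}{e^{i\theta}-z}\,k(e^{i\theta})\,\frac{d\theta}{2\pi}\Big),\qquad z\in\mathbb{D},$$ with $|c|=1$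 and $k$ a real-valued integrable function on the unit circle. **Theorem.** Let $0<\alpha<1$ and $0<p<\infty$, and let $f\not\equiv0$ be a function in $A^p_\alpha$. If $I$ is a nontrivial inner function dividing $f$, then $$\|f/I\|_{\alpha,p}<\|f\|_{\alpha,p}.$$ In particular, the outer part of $f$ belongs to $A^p_\alpha$: there are an inner function $I$ and an outer function $F$ with $f=IF$ in $\mathbb{D}$, and for every such factorization $F\in A^p_\alpha$. -/

import Mathlib

open scoped ENNReal Topology

noncomputable section

/-- The open unit disc. -/
def disc : Set ℂ := Metric.ball 0 1

/-- The integral mean `M_p^p(r, f)`, that is, the average of `|f|^p` over the circle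
of radius `r` about the origin. -/
def meanPow (p : ℝ) (f : ℂ → ℂ) (r : ℝ) : ℝ :=
  Real.circleAverage (fun z => ‖f z‖ ^ p) 0 r

/-- `‖f‖_{α,p}^p`, as an extended nonnegative number. For `f` analytic in the disc, the derivative
of `r ↦ M_p^p(r, f)` exists and is nonnegative on `(0, 1)`. -/
def aNormPow (α p : ℝ) (f : ℂ → ℂ) : ℝ≥0∞ :=
  ENNReal.ofReal (‖f 0‖ ^ p) +
    ∫⁻ r in Set.Ioo (0 : ℝ) 1,
      ENNReal.ofReal (deriv (meanPow p f) r * (1 - r ^ 2) ^ (α - 1))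

/-- `‖f‖_{α,p}`, as an extended nonnegative number. -/
def aNorm (α p : ℝ) (f : ℂ → ℂ) : ℝ≥0∞ := aNormPow α p f ^ (1 / p)

/-- The class `A^p_α`. -/
def MemA (α p : ℝ) (f : ℂ → ℂ) : Prop :=
  DifferentiableOn ℂ f disc ∧ aNorm α p f < ∞

/-- The Hardy space `H^p`: analytic functions in the disc with bounded integral means. -/
def MemHardy (p : ℝ) (f : ℂ → ℂ) : Prop :=
  DifferentiableOn ℂ f disc ∧ ∃ C : ℝ, ∀ r ∈ Set.Ioo (0 : ℝ) 1, meanPow p f r ≤ C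

/-- Inner functions: analytic functions in the disc, bounded by `1`, whose radial limits exist and
have modulus `1` at almost every point of the unit circle. -/
def IsInner (I : ℂ → ℂ) : Prop :=
  DifferentiableOn ℂ I disc ∧ (∀ z ∈ disc, ‖I z‖ ≤ 1) ∧
    ∀ᵐ θ : ℝ, ∃ w : ℂ, ‖w‖ = 1 ∧
      Filter.Tendsto (fun r : ℝ => I (circleMap 0 r θ)) (𝓝[<] 1) (𝓝 w)

/-- An inner function is nontrivial if it is not constant in the disc. -/
def InnerNontrivial (I : ℂ → ℂ) : Prop := ¬ ∃ c : ℂ, ∀ z ∈ disc, I z = c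

/-- Outer functions: `F(z) = c exp (1/(2π) ∫ (e^{iθ} + z)/(e^{iθ} - z) k(e^{iθ}) dθ)` with `|c| = 1`
and `k` a real-valued integrable function on the unit circle. -/
def IsOuter (F : ℂ → ℂ) : Prop :=
  ∃ (c : ℂ) (k : ℂ → ℝ), ‖c‖ = 1 ∧ CircleIntegrable k 0 1 ∧
    ∀ z ∈ disc, F z =
      c * Complex.exp (Real.circleAverage (fun ζ => herglotzRieszKernel 0 z ζ * (k ζ : ℂ)) 0 1)

/-- `g` is the quotient `f / I` witnessing that the inner function `I` divides `f` in `H^p`: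
`g` belongs to `H^p` and `f = I g` in the disc. -/
def IsHardyQuotient (p : ℝ) (f I g : ℂ → ℂ) : Prop :=
  MemHardy p g ∧ ∀ z ∈ disc, f z = I z * g z

/-- `f = I F` is an inner-outer factorization in the disc; `F` is then the outer part of `f`. -/
def IsInnerOuterFactorization (f I F : ℂ → ℂ) : Prop :=
  IsInner I ∧ IsOuter F ∧ ∀ z ∈ disc, f z = I z * F z

end

/-! Write `M(r)` for the mean of `|f|^p`, `w(r) = (1 - r²)^{α-1}`, and `A` for the limit of `M` at
1, finite because `w ≥ 1` puts `f` in `H^p`. Integration by parts (`aNormPow_eq`) gives `‖f‖^p = A +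
∫ w'(t) (A - M(t)) dt` with `w' > 0`. If `f = I g`, then `f` and `g` share the same `A`, since `|I|
= 1` on the boundary, while `|I| < 1` inside makes the mean of `f` strictly smaller than that of `g`
on all but countably many circles. Comparing the two formulas gives the strict inequality.

That `A` is the same for `f` and `g` needs boundary values. By Poisson–Jensen and Jensen's
inequality, `|g|^{p/2}` on a circle is dominated by the Poisson integral of its values on any larger
one. The Poisson operators are positive contractions of `L²`, so the squared `L²` distance between
two radii is at most 4 times the increment of the mean (`integral_sub_sq_le_of_le_polarPoisson`).
Bounded means therefore force `L²` convergence, with no maximal function, and Fatou's lemma does the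
rest.

For the factorization, Fatou's lemma applied to `|f|^q - q log|f| ≥ 0` shows that the boundary
function `κ` of `log|f|` is integrable and that its Poisson integral dominates `log|f|`. The outer
function `F` built from `κ` makes `f/F` bounded by 1; its radial limits exist by Fatou's theorem and
have modulus `e^κ/e^κ = 1`. Conversely, the outer factor of any factorization lies in `H^p`, so the
norm inequality, or the trivial case of constant `I`, puts it in `A^p_α`. -/

open scoped ENNReal Topology
open MeasureTheory Set Filter

/-! ### Normalized arc length. -/

/-- Normalized Lebesgue measure on `(0, 2π]`. -/
noncomputable def arcMeasure : Measure ℝ :=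
  ENNReal.ofReal (2 * Real.pi)⁻¹ • volume.restrict (Ioc 0 (2 * Real.pi))

theorem arcMeasure_integral (u : ℝ → ℝ) :
    ∫ θ, u θ ∂arcMeasure = (2 * Real.pi)⁻¹ * ∫ θ in (0 : ℝ)..(2 * Real.pi), u θ := by
  rw [arcMeasure, integral_smul_measure,
    intervalIntegral.integral_of_le (by positivity), ENNReal.toReal_ofReal (by positivity),
    smul_eq_mul]

theorem circleAverage_eq_arcMeasure (u : ℂ → ℝ) (r : ℝ) :
    Real.circleAverage u 0 r = ∫ θ, u (circleMap 0 r θ) ∂arcMeasure := by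
  rw [arcMeasure_integral, Real.circleAverage_def, smul_eq_mul]

instance : IsProbabilityMeasure arcMeasure := by
  constructor
  rw [arcMeasure, Measure.smul_apply, Measure.restrict_apply_univ, Real.volume_Ioc, smul_eq_mul,
    ← ENNReal.ofReal_mul (by positivity), sub_zero, inv_mul_cancel₀ (by positivity),
    ENNReal.ofReal_one]

theorem integrable_arcMeasure_iff {u : ℝ → ℝ} :
    Integrable u arcMeasure ↔ IntervalIntegrable u volume 0 (2 * Real.pi) := by
  rw [arcMeasure, integrable_smul_measure (by simp [Real.pi_pos]) ENNReal.ofReal_ne_top,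
    intervalIntegrable_iff_integrableOn_Ioc_of_le (by positivity)]
  rfl

theorem circleIntegrable_iff_arcMeasure {u : ℂ → ℝ} {r : ℝ} :
    CircleIntegrable u 0 r ↔ Integrable (fun θ => u (circleMap 0 r θ)) arcMeasure :=
  integrable_arcMeasure_iff.symm

theorem ae_arcMeasure_iff {q : ℝ → Prop} :
    (∀ᵐ θ ∂arcMeasure, q θ) ↔ ∀ᵐ θ ∂volume.restrict (Ioc 0 (2 * Real.pi)), q θ := by
  rw [arcMeasure, Measure.ae_ennreal_smul_measure_iff (by simp [Real.pi_pos])]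

theorem ae_arcMeasure_mem : ∀ᵐ θ ∂arcMeasure, θ ∈ Ioo 0 (2 * Real.pi) := by
  rw [ae_arcMeasure_iff, ← restrict_Ioo_eq_restrict_Ioc]
  exact ae_restrict_mem measurableSet_Ioo

theorem Continuous.integrable_arcMeasure {u : ℝ → ℝ} (hu : Continuous u) :
    Integrable u arcMeasure :=
  integrable_arcMeasure_iff.2 (hu.intervalIntegrable _ _)

theorem Continuous.integrable_arcMeasure_prod {u : ℝ × ℝ → ℝ} (hu : Continuous u) :
    Integrable u (arcMeasure.prod arcMeasure) := by
  have hK : IsCompact (Icc (0 : ℝ) (2 * Real.pi) ×ˢ Icc (0 : ℝ) (2 * Real.pi)) :=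
    isCompact_Icc.prod isCompact_Icc
  obtain ⟨C, hC⟩ := hK.exists_bound_of_continuousOn hu.continuousOn
  refine Integrable.of_bound hu.aestronglyMeasurable C ?_
  have h := ae_arcMeasure_mem
  filter_upwards [Measure.quasiMeasurePreserving_fst.ae h, Measure.quasiMeasurePreserving_snd.ae h]
    with x h1 h2
  exact hC x ⟨Ioo_subset_Icc_self h1, Ioo_subset_Icc_self h2⟩

/-! ### The Poisson kernel and its semigroup law. -/

/-- The Poisson kernel of the unit disc in polar form. -/
noncomputable def polarKernel (t x : ℝ) : ℝ := (1 - t ^ 2) / (1 - 2 * t * Real.cos x + t ^ 2)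

theorem polarKernel_denom_pos {t : ℝ} (ht : |t| < 1) (x : ℝ) :
    0 < 1 - 2 * t * Real.cos x + t ^ 2 := by
  have h1 := Real.neg_one_le_cos x
  have h2 := Real.cos_le_one x
  have h3 := abs_lt.1 ht
  nlinarith [sq_nonneg (t - Real.cos x), Real.sin_sq_add_cos_sq x, sq_nonneg (Real.sin x),
    mul_pos (sub_pos.2 h3.2) (neg_lt_iff_pos_add.1 h3.1)]

theorem polarKernel_pos {t : ℝ} (ht : |t| < 1) (x : ℝ) : 0 < polarKernel t x :=
  div_pos (by nlinarith [abs_lt.1 ht, sq_abs t, abs_nonneg t]) (polarKernel_denom_pos ht x)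

theorem continuous_polarKernel {t : ℝ} (ht : |t| < 1) : Continuous (polarKernel t) := by
  unfold polarKernel
  exact Continuous.div (by fun_prop) (by fun_prop) fun x => (polarKernel_denom_pos ht x).ne'

theorem polarKernel_neg (t x : ℝ) : polarKernel t (-x) = polarKernel t x := by
  simp [polarKernel]

theorem polarKernel_sub_comm (t x y : ℝ) : polarKernel t (x - y) = polarKernel t (y - x) := by
  rw [← polarKernel_neg, neg_sub]

theorem norm_circleMap_sub_sq (s ρ η θ : ℝ) :
    ‖circleMap 0 s η - circleMap 0 ρ θ‖ ^ 2 = s ^ 2 - 2 * s * ρ * Real.cos (θ - η) + ρ ^ 2 := by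
  rw [← Complex.normSq_eq_norm_sq, Complex.normSq_apply]
  simp only [circleMap, zero_add, Complex.sub_re, Complex.sub_im, Complex.mul_re, Complex.mul_im,
    Complex.ofReal_re, Complex.ofReal_im, Complex.exp_ofReal_mul_I_re,
    Complex.exp_ofReal_mul_I_im, zero_mul, sub_zero, add_zero, Real.cos_sub]
  nlinarith [Real.sin_sq_add_cos_sq η, Real.sin_sq_add_cos_sq θ]

theorem poissonKernel_circleMap {s : ℝ} (hs : 0 < s) (ρ θ η : ℝ) :
    poissonKernel 0 (circleMap 0 ρ θ) (circleMap 0 s η) = polarKernel (ρ / s) (θ - η) := by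
  rw [poissonKernel_def, polarKernel]
  simp only [sub_zero, norm_circleMap_sub_sq, norm_circleMap_zero, sq_abs]
  conv_rhs => rw [← mul_div_mul_left _ _ (pow_ne_zero 2 hs.ne' : s ^ 2 ≠ 0)]
  congr 1 <;> field_simp

/-- The Poisson integral of `u` at the point `t e^{iθ}`. -/
noncomputable def polarPoisson (t : ℝ) (u : ℝ → ℝ) (θ : ℝ) : ℝ :=
  ∫ η, polarKernel t (θ - η) * u η ∂arcMeasure

theorem circleAverage_poissonKernel_eq {s : ℝ} (hs : 0 < s) (u : ℂ → ℝ) (ρ θ : ℝ) :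
    Real.circleAverage (poissonKernel 0 (circleMap 0 ρ θ) • u) 0 s =
      polarPoisson (ρ / s) (fun η => u (circleMap 0 s η)) θ := by
  rw [circleAverage_eq_arcMeasure, polarPoisson]
  simp [poissonKernel_circleMap hs]

theorem polarPoisson_of_harmonic {H : ℂ → ℝ} {s ρ : ℝ} (hs : |ρ| < s)
    (hH : InnerProductSpace.HarmonicOnNhd H (Metric.closedBall 0 s)) (θ : ℝ) :
    polarPoisson (ρ / s) (fun η => H (circleMap 0 s η)) θ = H (circleMap 0 ρ θ) := by
  rw [← circleAverage_poissonKernel_eq ((abs_nonneg ρ).trans_lt hs)]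
  exact hH.circleAverage_poissonKernel_smul (by simpa using hs)

theorem integral_polarKernel {t : ℝ} (ht : |t| < 1) (θ : ℝ) :
    ∫ η, polarKernel t (θ - η) ∂arcMeasure = 1 := by
  have := polarPoisson_of_harmonic (H := fun _ => 1) (s := 1) ht
    (InnerProductSpace.harmonicOnNhd_const 1) θ
  simpa [polarPoisson] using this

theorem integral_polarKernel' {t : ℝ} (ht : |t| < 1) (θ : ℝ) :
    ∫ η, polarKernel t (η - θ) ∂arcMeasure = 1 := by
  simp_rw [polarKernel_sub_comm t _ θ, integral_polarKernel ht]

/-- In its first point the second kernel is the real part of a Herglotz kernel at `t z`. This is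
harmonic up to the unit circle because `|t| < 1`, so the Poisson formula reproduces it. -/
theorem polarKernel_semigroup {s t : ℝ} (hs : |s| < 1) (ht : |t| < 1) (θ ξ : ℝ) :
    ∫ η, polarKernel s (θ - η) * polarKernel t (η - ξ) ∂arcMeasure =
      polarKernel (s * t) (θ - ξ) := by
  have key : ∀ ρ η : ℝ, (herglotzRieszKernel 0 (t * circleMap 0 ρ η) (circleMap 0 1 ξ)).re =
      polarKernel (ρ * t) (η - ξ) := by
    intro ρ η
    have h1 : (t : ℂ) * circleMap 0 ρ η = circleMap 0 (ρ * t) η := by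
      simp [circleMap]; ring
    rw [h1]
    have := poissonKernel_circleMap one_pos (ρ * t) η ξ
    rw [poissonKernel_eq_re_herglotzRieszKernel, div_one] at this
    exact this
  have hH : InnerProductSpace.HarmonicOnNhd
      (fun z : ℂ => (herglotzRieszKernel 0 (t * z) (circleMap 0 1 ξ)).re)
      (Metric.closedBall 0 1) := by
    intro z hz
    apply AnalyticAt.harmonicAt_re
    simp only [herglotzRieszKernel_def, sub_zero]
    have hne : circleMap 0 1 ξ - t * z ≠ 0 := by
      intro h
      have h2 : ‖circleMap 0 1 ξ‖ = ‖(t : ℂ) * z‖ := by rw [sub_eq_zero.1 h]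
      rw [norm_circleMap_zero, norm_mul, Complex.norm_real, Real.norm_eq_abs, abs_one] at h2
      have h3 : ‖z‖ ≤ 1 := by simpa using hz
      nlinarith [abs_nonneg t, norm_nonneg z]
    fun_prop (disch := assumption)
  have := polarPoisson_of_harmonic (s := 1) hs hH θ
  simpa only [polarPoisson, key, div_one, one_mul] using this

/-! ### Poisson integrals as positive contractions of `L²`. -/

theorem continuous_polarPoisson {t : ℝ} (ht : |t| < 1) {u : ℝ → ℝ} (hu : Continuous u) :
    Continuous (polarPoisson t u) := by
  have h : polarPoisson t u = fun θ => (2 * Real.pi)⁻¹ *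
      ∫ η in (0 : ℝ)..(2 * Real.pi), polarKernel t (θ - η) * u η := by
    ext θ; rw [polarPoisson, arcMeasure_integral]
  rw [h]
  have hk := continuous_polarKernel ht
  exact continuous_const.mul
    (intervalIntegral.continuous_parametric_intervalIntegral_of_continuous' (by fun_prop) _ _)

theorem integrable_polarKernel_mul {t : ℝ} (ht : |t| < 1) {u : ℝ → ℝ} (hu : Integrable u arcMeasure)
    (θ : ℝ) : Integrable (fun η => polarKernel t (θ - η) * u η) arcMeasure := by
  have hk := continuous_polarKernel ht
  obtain ⟨C, hC⟩ := (isCompact_Icc (a := (0 : ℝ)) (b := 2 * Real.pi)).exists_bound_of_continuousOn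
    (f := fun η => polarKernel t (θ - η)) (by fun_prop)
  refine hu.bdd_mul (c := C) (by fun_prop) ?_
  filter_upwards [ae_arcMeasure_mem] with η hη using hC η (Ioo_subset_Icc_self hη)

theorem integral_mul_polarPoisson {t : ℝ} (ht : |t| < 1) {u v : ℝ → ℝ} (hu : Continuous u)
    (hv : Continuous v) :
    ∫ θ, v θ * polarPoisson t u θ ∂arcMeasure = ∫ θ, polarPoisson t v θ * u θ ∂arcMeasure := by
  have hk := continuous_polarKernel ht
  simp only [polarPoisson, ← integral_const_mul, ← integral_mul_const]
  rw [integral_integral_swap]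
  · refine integral_congr_ae (.of_forall fun η => integral_congr_ae (.of_forall fun θ => ?_))
    simp only [polarKernel_sub_comm t η θ]; ring
  · exact Continuous.integrable_arcMeasure_prod (by simp only [Function.uncurry_def]; fun_prop)

theorem polarPoisson_const_one {t : ℝ} (ht : |t| < 1) : polarPoisson t (fun _ => 1) = fun _ => 1 := by
  ext θ; simp [polarPoisson, integral_polarKernel ht]

theorem integral_polarPoisson {t : ℝ} (ht : |t| < 1) {u : ℝ → ℝ} (hu : Continuous u) :
    ∫ θ, polarPoisson t u θ ∂arcMeasure = ∫ θ, u θ ∂arcMeasure := by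
  simpa [polarPoisson_const_one ht] using
    integral_mul_polarPoisson ht hu (continuous_const (y := (1 : ℝ)))

theorem polarPoisson_polarPoisson {s t : ℝ} (hs : |s| < 1) (ht : |t| < 1) {u : ℝ → ℝ}
    (hu : Continuous u) : polarPoisson s (polarPoisson t u) = polarPoisson (s * t) u := by
  have hk := continuous_polarKernel ht
  have hk' := continuous_polarKernel hs
  ext θ
  simp only [polarPoisson, ← integral_const_mul]
  rw [integral_integral_swap]
  · refine integral_congr_ae (.of_forall fun ξ => ?_)
    simp only [← mul_assoc]
    rw [integral_mul_const, polarKernel_semigroup hs ht]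
  · exact Continuous.integrable_arcMeasure_prod (by simp only [Function.uncurry_def]; fun_prop)

/-- The kernel is a probability density with respect to which `u` has mean `m`; its variance is
nonnegative. -/
theorem sq_polarPoisson_le {t : ℝ} (ht : |t| < 1) {u : ℝ → ℝ} (hu : Continuous u) (θ : ℝ) :
    polarPoisson t u θ ^ 2 ≤ polarPoisson t (fun η => u η ^ 2) θ := by
  set m := polarPoisson t u θ with hm
  have h0 : 0 ≤ ∫ η, polarKernel t (θ - η) * (u η - m) ^ 2 ∂arcMeasure :=
    integral_nonneg fun η => mul_nonneg (polarKernel_pos ht _).le (sq_nonneg _)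
  have i1 := integrable_polarKernel_mul ht (u := fun η => u η ^ 2)
    (Continuous.integrable_arcMeasure (by fun_prop)) θ
  have i2 := integrable_polarKernel_mul ht hu.integrable_arcMeasure θ
  have i3 : Integrable (fun η => polarKernel t (θ - η)) arcMeasure := by
    simpa using integrable_polarKernel_mul ht (integrable_const (1 : ℝ)) θ
  have h1 : ∫ η, polarKernel t (θ - η) * (u η - m) ^ 2 ∂arcMeasure =
      ∫ η, (polarKernel t (θ - η) * u η ^ 2 - (2 * m) * (polarKernel t (θ - η) * u η) +
        m ^ 2 * polarKernel t (θ - η)) ∂arcMeasure := by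
    congr 1; ext η; ring
  have i4 : Integrable (fun η => polarKernel t (θ - η) * u η ^ 2 -
      (2 * m) * (polarKernel t (θ - η) * u η)) arcMeasure := i1.sub (i2.const_mul _)
  rw [h1, integral_add i4 (i3.const_mul _), integral_sub i1 (i2.const_mul _),
    integral_const_mul, integral_const_mul, integral_polarKernel ht] at h0
  change 0 ≤ polarPoisson t (fun η => u η ^ 2) θ - 2 * m * polarPoisson t u θ + m ^ 2 * 1 at h0
  rw [← hm] at h0
  nlinarith

theorem integral_sq_polarPoisson_le {t : ℝ} (ht : |t| < 1) {u : ℝ → ℝ} (hu : Continuous u) :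
    ∫ θ, polarPoisson t u θ ^ 2 ∂arcMeasure ≤ ∫ θ, u θ ^ 2 ∂arcMeasure := by
  rw [← integral_polarPoisson ht (u := fun θ => u θ ^ 2) (by fun_prop)]
  refine integral_mono ?_ ?_ (sq_polarPoisson_le ht hu)
  · exact ((continuous_polarPoisson ht hu).pow 2).integrable_arcMeasure
  · exact (continuous_polarPoisson ht (by fun_prop)).integrable_arcMeasure

/-- With `S` the operator of parameter `√t`, the semigroup law gives `P_t = S²`. As `S` is a
symmetric contraction, `‖S²u‖² ≤ ‖Su‖² = ⟨u, S²u⟩`. -/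
theorem integral_sq_polarPoisson_le_inner {t : ℝ} (h0 : 0 ≤ t) (ht : t < 1) {u : ℝ → ℝ}
    (hu : Continuous u) :
    ∫ θ, polarPoisson t u θ ^ 2 ∂arcMeasure ≤ ∫ θ, u θ * polarPoisson t u θ ∂arcMeasure := by
  have hs : |√t| < 1 := by
    rw [abs_of_nonneg (Real.sqrt_nonneg t)]
    exact (Real.sqrt_lt' one_pos).2 (by simpa using ht)
  have hst : √t * √t = t := Real.mul_self_sqrt h0
  have hc := continuous_polarPoisson hs hu
  calc ∫ θ, polarPoisson t u θ ^ 2 ∂arcMeasure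
      = ∫ θ, polarPoisson √t (polarPoisson √t u) θ ^ 2 ∂arcMeasure := by
        rw [polarPoisson_polarPoisson hs hs hu, hst]
    _ ≤ ∫ θ, polarPoisson √t u θ ^ 2 ∂arcMeasure := integral_sq_polarPoisson_le hs hc
    _ = ∫ θ, u θ * polarPoisson √t (polarPoisson √t u) θ ∂arcMeasure := by
        rw [integral_mul_polarPoisson hs hc hu]; simp [sq]
    _ = _ := by rw [polarPoisson_polarPoisson hs hs hu, hst]

/-- Quantitative strong convergence: a function dominated by a Poisson integral is close in `L²` to
the boundary function if the norms are close. -/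
theorem integral_sub_sq_le_of_le_polarPoisson {t : ℝ} (h0 : 0 ≤ t) (ht : t < 1) {u v : ℝ → ℝ}
    (hu : Continuous u) (hv : Continuous v) (hv0 : ∀ θ, 0 ≤ v θ)
    (hvu : ∀ θ, v θ ≤ polarPoisson t u θ) :
    ∫ θ, (u θ - v θ) ^ 2 ∂arcMeasure ≤
      4 * (∫ θ, u θ ^ 2 ∂arcMeasure - ∫ θ, v θ ^ 2 ∂arcMeasure) := by
  have ht' : |t| < 1 := by rwa [abs_of_nonneg h0]
  have hw := continuous_polarPoisson ht' hu
  set w := polarPoisson t u with hwdef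
  have e1 : ∫ θ, w θ ^ 2 ∂arcMeasure ≤ ∫ θ, u θ * w θ ∂arcMeasure :=
    integral_sq_polarPoisson_le_inner h0 ht hu
  have e2 : ∫ θ, w θ ^ 2 ∂arcMeasure ≤ ∫ θ, u θ ^ 2 ∂arcMeasure :=
    integral_sq_polarPoisson_le ht' hu
  have iu : Integrable (fun θ => u θ ^ 2) arcMeasure := (hu.pow 2).integrable_arcMeasure
  have iv : Integrable (fun θ => v θ ^ 2) arcMeasure := (hv.pow 2).integrable_arcMeasure
  have iw : Integrable (fun θ => w θ ^ 2) arcMeasure := (hw.pow 2).integrable_arcMeasure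
  have iuw : Integrable (fun θ => u θ * w θ) arcMeasure := (hu.mul hw).integrable_arcMeasure
  have j1 : Integrable (fun θ => 2 * u θ ^ 2 - 4 * (u θ * w θ)) arcMeasure :=
    (iu.const_mul _).sub (iuw.const_mul _)
  have j2 : Integrable (fun θ => 2 * u θ ^ 2 - 4 * (u θ * w θ) + 4 * w θ ^ 2) arcMeasure :=
    j1.add (iw.const_mul _)
  have h1 : ∫ θ, (u θ - v θ) ^ 2 ∂arcMeasure ≤
      ∫ θ, (2 * u θ ^ 2 - 4 * (u θ * w θ) + 4 * w θ ^ 2 - 2 * v θ ^ 2) ∂arcMeasure := by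
    refine integral_mono ((hu.sub hv).pow 2).integrable_arcMeasure
      (j2.sub (iv.const_mul _)) ?_
    intro θ
    have a := hvu θ
    have b := hv0 θ
    simp only
    -- `(u - v)² ≤ 2(u - w)² + 2(w - v)²`, and `(w - v)² ≤ w² - v²` because `0 ≤ v ≤ w`.
    nlinarith [sq_nonneg (u θ - w θ - (w θ - v θ)), mul_nonneg b (sub_nonneg.2 a)]
  rw [integral_sub j2 (iv.const_mul _), integral_add j1 (iw.const_mul _),
    integral_sub (iu.const_mul _) (iuw.const_mul _)] at h1
  simp only [integral_const_mul] at h1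
  have e3 : ∫ θ, v θ ^ 2 ∂arcMeasure ≤ ∫ θ, w θ ^ 2 ∂arcMeasure :=
    integral_mono iv iw fun θ => pow_le_pow_left₀ (hv0 θ) (hvu θ) 2
  linarith

/-! ### The Poisson–Jensen inequality. -/

/-- By compactness the divisor on the closed disc has finite support. Zeros on the bounding circle
are extracted too, so `g` is zero-free up to the boundary. -/
theorem AnalyticOnNhd.exists_eq_prod_sub_pow_mul {f : ℂ → ℂ} {R : ℝ} (hR : 0 < R)
    (hf : AnalyticOnNhd ℂ f (Metric.closedBall 0 R)) (h0 : ∃ z ∈ Metric.closedBall 0 R, f z ≠ 0) :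
    ∃ (s : Finset ℂ) (n : ℂ → ℕ) (g : ℂ → ℂ), (∀ a ∈ s, a ∈ Metric.closedBall 0 R) ∧
      AnalyticOnNhd ℂ g (Metric.closedBall 0 R) ∧ (∀ z ∈ Metric.closedBall 0 R, g z ≠ 0) ∧
      ∀ z ∈ Metric.closedBall 0 R, f z = (∏ a ∈ s, (z - a) ^ n a) * g z := by
  have hfm : MeromorphicOn f (Metric.closedBall 0 R) := hf.meromorphicOn
  set D := MeromorphicOn.divisor f (Metric.closedBall 0 R) with hD
  have hfin : D.support.Finite := D.finiteSupport (isCompact_closedBall 0 R)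
  have hD0 : 0 ≤ D := MeromorphicOn.AnalyticOnNhd.divisor_nonneg hf
  have hpre : IsPreconnected (Metric.closedBall (0 : ℂ) R) :=
    (convex_closedBall (0 : ℂ) R).isPreconnected
  have horder : ∀ u : Metric.closedBall (0 : ℂ) R, meromorphicOrderAt f u ≠ ⊤ := by
    obtain ⟨z, hz, hfz⟩ := h0
    rw [← hfm.exists_meromorphicOrderAt_ne_top_iff_forall ⟨⟨0, by simp [hR.le]⟩, hpre⟩]
    refine ⟨⟨z, hz⟩, ?_⟩
    have : meromorphicOrderAt f z = 0 :=
      ((hf z hz).meromorphicNFAt.meromorphicOrderAt_eq_zero_iff).2 hfz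
    simp [this]
  obtain ⟨g, hg, hg0, hfg⟩ := hfm.extract_zeros_poles horder hfin
  rw [← hD] at hfg
  have hprod : (∏ᶠ u, (fun z : ℂ => z - u) ^ D u) =
      fun z => ∏ a ∈ hfin.toFinset, (z - a) ^ (D a).toNat := by
    rw [finprod_eq_prod_of_mulSupport_subset (s := hfin.toFinset)]
    · ext z
      rw [Finset.prod_apply]
      refine Finset.prod_congr rfl fun a _ => ?_
      rw [Pi.pow_apply, ← zpow_natCast, Int.toNat_of_nonneg (hD0 a)]
    · intro u hu
      simp only [Finite.coe_toFinset, Function.mem_support]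
      intro h
      simp [h] at hu
  refine ⟨hfin.toFinset, fun a => (D a).toNat, g, fun a ha => ?_, hg, fun z hz => hg0 ⟨z, hz⟩, ?_⟩
  · exact D.supportWithinDomain (by simpa using ha)
  -- The extraction gives equality only off a discrete set; continuity extends it to the open disc,
  -- then to the closure.
  · have hcF : ContinuousOn (fun z => (∏ a ∈ hfin.toFinset, (z - a) ^ (D a).toNat) * g z)
        (Metric.closedBall 0 R) := by
      refine ContinuousOn.mul ?_ hg.continuousOn
      fun_prop
    have hball : EqOn f (fun z => (∏ a ∈ hfin.toFinset, (z - a) ^ (D a).toNat) * g z)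
        (Metric.ball 0 R) := by
      intro x hx
      have hmem := mem_codiscreteWithin.1 hfg x (Metric.ball_subset_closedBall hx)
      rw [disjoint_principal_right] at hmem
      have hev : ∀ᶠ y in 𝓝[≠] x,
          f y = (∏ a ∈ hfin.toFinset, (y - a) ^ (D a).toNat) * g y := by
        have hb : ∀ᶠ y in 𝓝[≠] x, y ∈ Metric.ball (0 : ℂ) R :=
          nhdsWithin_le_nhds (Metric.isOpen_ball.mem_nhds hx)
        filter_upwards [hmem, hb] with y hy hy2
        by_contra hne
        apply hy
        refine ⟨Metric.ball_subset_closedBall hy2, ?_⟩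
        simp only [mem_ofPred_eq, hprod]
        exact hne
      have c1 : Tendsto f (𝓝[≠] x) (𝓝 (f x)) :=
        ((hf x (Metric.ball_subset_closedBall hx)).continuousAt).mono_left nhdsWithin_le_nhds
      have c2 := ((hcF.continuousAt (Metric.closedBall_mem_nhds_of_mem hx))).mono_left
        (nhdsWithin_le_nhds (s := {x}ᶜ))
      exact tendsto_nhds_unique (c1.congr' hev) c2
    exact hball.of_subset_closure hf.continuousOn hcF Metric.ball_subset_closedBall
      (by rw [closure_ball _ hR.ne'])

theorem polarPoisson_add {t : ℝ} (ht : |t| < 1) {u v : ℝ → ℝ} (hu : Integrable u arcMeasure)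
    (hv : Integrable v arcMeasure) (θ : ℝ) :
    polarPoisson t (fun η => u η + v η) θ = polarPoisson t u θ + polarPoisson t v θ := by
  simp only [polarPoisson, mul_add]
  exact integral_add (integrable_polarKernel_mul ht hu θ) (integrable_polarKernel_mul ht hv θ)

theorem polarPoisson_const_mul (t c : ℝ) (u : ℝ → ℝ) (θ : ℝ) :
    polarPoisson t (fun η => c * u η) θ = c * polarPoisson t u θ := by
  simp only [polarPoisson, ← integral_const_mul]
  congr 1; ext η; ring

theorem polarPoisson_sum {ι : Type*} {t : ℝ} (ht : |t| < 1) (s : Finset ι) {u : ι → ℝ → ℝ}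
    (hu : ∀ i ∈ s, Integrable (u i) arcMeasure) (θ : ℝ) :
    polarPoisson t (fun η => ∑ i ∈ s, u i η) θ = ∑ i ∈ s, polarPoisson t (u i) θ := by
  simp only [polarPoisson, Finset.mul_sum]
  exact integral_finsetSum s fun i hi => integrable_polarKernel_mul ht (hu i hi) θ

theorem polarPoisson_congr_ae {t : ℝ} {u v : ℝ → ℝ} (huv : u =ᵐ[arcMeasure] v) (θ : ℝ) :
    polarPoisson t u θ = polarPoisson t v θ := by
  refine integral_congr_ae ?_
  filter_upwards [huv] with η h
  rw [h]

theorem ae_arcMeasure_circleMap_notMem {s : Set ℂ} (hs : s.Countable) {R : ℝ} (hR : R ≠ 0) :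
    ∀ᵐ θ ∂arcMeasure, circleMap 0 R θ ∉ s := by
  rw [ae_arcMeasure_iff]
  exact ae_restrict_of_ae
    (measure_eq_zero_iff_ae_notMem.1 ((hs.preimage_circleMap 0 hR).measure_zero _))

theorem integrable_log_norm_circleMap {f : ℂ → ℂ} {R : ℝ} (hR : 0 < R)
    (hf : AnalyticOnNhd ℂ f (Metric.closedBall 0 R)) :
    Integrable (fun θ => Real.log ‖f (circleMap 0 R θ)‖) arcMeasure := by
  rw [← circleIntegrable_iff_arcMeasure (u := fun z => Real.log ‖f z‖)]
  refine MeromorphicOn.circleIntegrable_log_norm ?_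
  rw [abs_of_pos hR]
  exact (hf.mono Metric.sphere_subset_closedBall).meromorphicOn

/-- If `|a| < R`, the reflected factor `R - conj(a) z / R` has the modulus of `z - a` on the circle,
a larger one inside, and no zero in the closed disc, so its log-modulus is harmonic. If `|a| = R`,
equality holds despite the logarithmic singularity. -/
theorem log_norm_sub_le_polarPoisson {a : ℂ} {R ρ : ℝ} (hρ : |ρ| < R)
    (ha : a ∈ Metric.closedBall 0 R) (θ : ℝ) (hne : circleMap 0 ρ θ ≠ a) :
    Real.log ‖circleMap 0 ρ θ - a‖ ≤
      polarPoisson (ρ / R) (fun η => Real.log ‖circleMap 0 R η - a‖) θ := by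
  have hR : 0 < R := (abs_nonneg ρ).trans_lt hρ
  have hw : circleMap 0 ρ θ ∈ Metric.ball (0 : ℂ) R := by simpa using hρ
  rw [mem_closedBall_zero_iff] at ha
  rcases ha.lt_or_eq with ha | ha
  · have hH : InnerProductSpace.HarmonicOnNhd
        (fun z : ℂ => Real.log ‖(R : ℂ) - (starRingEnd ℂ) a * z / R‖)
        (Metric.closedBall 0 R) := by
      intro z hz
      refine AnalyticAt.harmonicAt_log_norm (by fun_prop) ?_
      intro h
      have h2 : ‖(R : ℂ)‖ = ‖(starRingEnd ℂ) a * z / R‖ := congrArg _ (sub_eq_zero.1 h)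
      rw [norm_div, norm_mul, Complex.norm_real, Real.norm_of_nonneg hR.le, RCLike.norm_conj,
        eq_div_iff hR.ne'] at h2
      have h3 : ‖z‖ ≤ R := by simpa using hz
      nlinarith [norm_nonneg a, norm_nonneg z]
    have key : ∀ z : ℂ, ‖(R : ℂ) - (starRingEnd ℂ) a * z / R‖ ^ 2 - ‖z - a‖ ^ 2 =
        (R ^ 2 - ‖a‖ ^ 2) * (R ^ 2 - ‖z‖ ^ 2) / R ^ 2 := by
      intro z
      have e : (R : ℂ) - (starRingEnd ℂ) a * z / R =
          ⟨R - (a.re * z.re + a.im * z.im) / R, -((a.re * z.im - a.im * z.re) / R)⟩ := by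
        apply Complex.ext
        · simp [Complex.div_ofReal_re]
        · simp [Complex.div_ofReal_im]; ring
      rw [e]
      simp only [← Complex.normSq_eq_norm_sq, Complex.normSq_apply, Complex.sub_re, Complex.sub_im]
      field_simp
      ring
    have hP := polarPoisson_of_harmonic hρ hH θ
    have hc : (fun η => Real.log ‖circleMap 0 R η - a‖) = fun η =>
        Real.log ‖(R : ℂ) - (starRingEnd ℂ) a * circleMap 0 R η / R‖ := by
      ext η
      congr 1
      have := key (circleMap 0 R η)
      rw [norm_circleMap_zero, sq_abs, sub_self, mul_zero, zero_div, sub_eq_zero] at this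
      exact ((sq_eq_sq₀ (norm_nonneg _) (norm_nonneg _)).1 this).symm
    rw [hc, hP]
    refine Real.log_le_log (norm_pos_iff.2 (sub_ne_zero.2 hne)) ?_
    refine le_of_sq_le_sq ?_ (norm_nonneg _)
    have := key (circleMap 0 ρ θ)
    rw [norm_circleMap_zero, sq_abs] at this
    have h1 : 0 ≤ (R ^ 2 - ‖a‖ ^ 2) * (R ^ 2 - ρ ^ 2) / R ^ 2 := by
      have h2 : ρ ^ 2 ≤ R ^ 2 := by rw [← sq_abs ρ]; exact pow_le_pow_left₀ (abs_nonneg _) hρ.le 2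
      have h3 : ‖a‖ ^ 2 ≤ R ^ 2 := pow_le_pow_left₀ (norm_nonneg _) ha.le 2
      exact div_nonneg (mul_nonneg (by linarith) (by linarith)) (sq_nonneg R)
    linarith
  · have h := circleAverage_re_herglotzRieszKernel_mul_log₀ (ρ := a) (w := circleMap 0 ρ θ) (R := R)
      (by simpa using ha) hw
    rw [← poissonKernel_eq_re_herglotzRieszKernel, circleAverage_poissonKernel_eq hR] at h
    exact h.symm.le

/-- The Poisson–Jensen inequality. -/
theorem log_norm_le_polarPoisson {f : ℂ → ℂ} {R ρ : ℝ} (hρ : |ρ| < R)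
    (hf : AnalyticOnNhd ℂ f (Metric.closedBall 0 R)) (θ : ℝ) (hne : f (circleMap 0 ρ θ) ≠ 0) :
    Real.log ‖f (circleMap 0 ρ θ)‖ ≤
      polarPoisson (ρ / R) (fun η => Real.log ‖f (circleMap 0 R η)‖) θ := by
  have hR : 0 < R := (abs_nonneg ρ).trans_lt hρ
  have ht : |ρ / R| < 1 := by rwa [abs_div, abs_of_pos hR, div_lt_one hR]
  have hw : circleMap 0 ρ θ ∈ Metric.closedBall (0 : ℂ) R := by simpa using hρ.le
  obtain ⟨s, n, g, hs, hg, hg0, hfg⟩ := hf.exists_eq_prod_sub_pow_mul hR ⟨_, hw, hne⟩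
  -- Only points with `n a ≠ 0` need be avoided: `f z ≠ 0` says nothing about those of exponent
  -- zero.
  have hlog : ∀ z ∈ Metric.closedBall (0 : ℂ) R, (∀ a ∈ s, n a ≠ 0 → z ≠ a) →
      Real.log ‖f z‖ = ∑ a ∈ s, n a * Real.log ‖z - a‖ + Real.log ‖g z‖ := by
    intro z hz hza
    have h1 : ∀ a ∈ s, ‖(z - a) ^ n a‖ ≠ 0 := by
      intro a ha
      by_cases h : n a = 0
      · simp [h]
      · exact norm_ne_zero_iff.2 (pow_ne_zero _ (sub_ne_zero.2 (hza a ha h)))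
    rw [hfg z hz, norm_mul, norm_prod, Real.log_mul (Finset.prod_ne_zero_iff.2 h1)
      (norm_ne_zero_iff.2 (hg0 z hz)), Real.log_prod h1]
    simp
  have hint : ∀ a : ℂ, Integrable (fun η => Real.log ‖circleMap 0 R η - a‖) arcMeasure := fun a =>
    integrable_log_norm_circleMap (f := fun z => z - a) hR fun z _ => by fun_prop
  have hsph : ∀ η, circleMap 0 R η ∈ Metric.closedBall (0 : ℂ) R := by
    intro η; simp [abs_of_pos hR]
  have hae : (fun η => Real.log ‖f (circleMap 0 R η)‖) =ᵐ[arcMeasure] fun η =>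
      ∑ a ∈ s, n a * Real.log ‖circleMap 0 R η - a‖ + Real.log ‖g (circleMap 0 R η)‖ := by
    filter_upwards [ae_arcMeasure_circleMap_notMem s.finite_toSet.countable hR.ne'] with η hη
    exact hlog _ (hsph η) fun a ha _ h => hη (h ▸ ha)
  have hwa : ∀ a ∈ s, n a ≠ 0 → circleMap 0 ρ θ ≠ a := by
    intro a ha hna h
    apply hne
    rw [hfg _ hw, Finset.prod_eq_zero ha (by rw [h, sub_self, zero_pow hna]), zero_mul]
  have hgh : InnerProductSpace.HarmonicOnNhd (fun z => Real.log ‖g z‖) (Metric.closedBall 0 R) :=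
    fun z hz => (hg z hz).harmonicAt_log_norm (hg0 z hz)
  rw [polarPoisson_congr_ae hae, polarPoisson_add ht
    (integrable_finsetSum _ fun a _ => (hint a).const_mul _) (integrable_log_norm_circleMap hR hg),
    polarPoisson_sum ht _ fun a _ => (hint a).const_mul _, hlog _ hw hwa,
    polarPoisson_of_harmonic hρ hgh]
  refine add_le_add (Finset.sum_le_sum fun a ha => ?_) le_rfl
  rw [polarPoisson_const_mul]
  by_cases h : n a = 0
  · simp [h]
  · exact mul_le_mul_of_nonneg_left (log_norm_sub_le_polarPoisson hρ (hs a ha) θ (hwa a ha h))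
      (Nat.cast_nonneg _)

/-- Jensen's inequality: integrate the tangent line bound `e^u ≥ e^m (u - m + 1)` against the
kernel. -/
theorem exp_polarPoisson_le {t : ℝ} (ht : |t| < 1) {u : ℝ → ℝ} (hu : Integrable u arcMeasure)
    (he : Integrable (fun η => Real.exp (u η)) arcMeasure) (θ : ℝ) :
    Real.exp (polarPoisson t u θ) ≤ polarPoisson t (fun η => Real.exp (u η)) θ := by
  set m := polarPoisson t u θ with hm
  have i3 : Integrable (fun η => polarKernel t (θ - η)) arcMeasure := by
    simpa using integrable_polarKernel_mul ht (integrable_const (1 : ℝ)) θ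
  have i1 := integrable_polarKernel_mul ht hu θ
  have i2 := integrable_polarKernel_mul ht he θ
  have h1 : ∫ η, (Real.exp m * (polarKernel t (θ - η) * u η) +
      (Real.exp m * (1 - m)) * polarKernel t (θ - η)) ∂arcMeasure ≤
      polarPoisson t (fun η => Real.exp (u η)) θ := by
    refine integral_mono ((i1.const_mul _).add (i3.const_mul _)) i2 fun η => ?_
    have h2 : Real.exp m * (u η - m + 1) ≤ Real.exp (u η) := by
      have := Real.add_one_le_exp (u η - m)
      calc _ ≤ Real.exp m * Real.exp (u η - m) := by gcongr
        _ = _ := by rw [← Real.exp_add]; ring_nf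
    have h3 := mul_le_mul_of_nonneg_left h2 (polarKernel_pos ht (θ - η)).le
    simp only
    linarith
  rw [integral_add (i1.const_mul _) (i3.const_mul _), integral_const_mul, integral_const_mul,
    integral_polarKernel ht] at h1
  change Real.exp m * polarPoisson t u θ + _ ≤ _ at h1
  rw [← hm] at h1
  linarith

/-- Powers of moduli of analytic functions are dominated by their Poisson integrals. -/
theorem norm_rpow_le_polarPoisson {f : ℂ → ℂ} {R ρ q : ℝ} (hq : 0 < q) (hρ : |ρ| < R)
    (hf : AnalyticOnNhd ℂ f (Metric.closedBall 0 R)) (θ : ℝ) :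
    ‖f (circleMap 0 ρ θ)‖ ^ q ≤
      polarPoisson (ρ / R) (fun η => ‖f (circleMap 0 R η)‖ ^ q) θ := by
  have hR : 0 < R := (abs_nonneg ρ).trans_lt hρ
  have ht : |ρ / R| < 1 := by rwa [abs_div, abs_of_pos hR, div_lt_one hR]
  have hw : circleMap 0 ρ θ ∈ Metric.closedBall (0 : ℂ) R := by simpa using hρ.le
  by_cases hne : f (circleMap 0 ρ θ) = 0
  · rw [hne, norm_zero, Real.zero_rpow hq.ne']
    exact integral_nonneg fun η => mul_nonneg (polarKernel_pos ht _).le (by positivity)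
  obtain ⟨s, n, g, hs, hg, hg0, hfg⟩ := hf.exists_eq_prod_sub_pow_mul hR ⟨_, hw, hne⟩
  have hsph : ∀ η, circleMap 0 R η ∈ Metric.closedBall (0 : ℂ) R := by
    intro η; simp [abs_of_pos hR]
  -- At a zero of `f` the convention `log 0 = 0` makes the left side 1, hence equality only almost
  -- everywhere.
  have hae : (fun η => Real.exp (q * Real.log ‖f (circleMap 0 R η)‖)) =ᵐ[arcMeasure]
      fun η => ‖f (circleMap 0 R η)‖ ^ q := by
    filter_upwards [ae_arcMeasure_circleMap_notMem s.finite_toSet.countable hR.ne'] with η hη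
    have h1 : 0 < ‖f (circleMap 0 R η)‖ := by
      rw [norm_pos_iff, hfg _ (hsph η)]
      refine mul_ne_zero (Finset.prod_ne_zero_iff.2 fun a ha => pow_ne_zero _
        (sub_ne_zero.2 fun h => hη (h ▸ ha))) (hg0 _ (hsph η))
    rw [Real.rpow_def_of_pos h1, mul_comm]
  have hlog := (integrable_log_norm_circleMap hR hf).const_mul q
  have hcont : Continuous fun η => ‖f (circleMap 0 R η)‖ ^ q := by
    have h1 : Continuous fun η => f (circleMap 0 R η) :=
      hf.continuousOn.comp_continuous (continuous_circleMap 0 R) hsph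
    exact h1.norm.rpow_const fun _ => Or.inr hq.le
  rw [← polarPoisson_congr_ae hae, Real.rpow_def_of_pos (norm_pos_iff.2 hne), mul_comm]
  refine le_trans (Real.exp_le_exp.2 ?_) (exp_polarPoisson_le ht hlog
    (hcont.integrable_arcMeasure.congr hae.symm) θ)
  rw [polarPoisson_const_mul]
  exact mul_le_mul_of_nonneg_left (log_norm_le_polarPoisson hρ hf θ hne) hq.le

/-! ### Boundary functions in `L²`. -/

theorem circleMap_mem_disc {r : ℝ} (h0 : 0 ≤ r) (h1 : r < 1) (θ : ℝ) : circleMap 0 r θ ∈ disc := by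
  simp [disc, abs_of_nonneg h0, h1]

theorem ContinuousOn.continuous_circleMap_of_disc {E : Type*} [TopologicalSpace E] {u : ℂ → E}
    (hu : ContinuousOn u disc) {r : ℝ} (h0 : 0 ≤ r) (h1 : r < 1) :
    Continuous fun θ => u (circleMap 0 r θ) :=
  hu.comp_continuous (continuous_circleMap 0 r) (circleMap_mem_disc h0 h1)

/-- Nonnegative continuous functions in the unit disc dominated on each smaller circle by
the Poisson integral of their values on a larger circle. -/
structure PoissonDominated (u : ℂ → ℝ) : Prop where
  continuousOn : ContinuousOn u disc
  nonneg : ∀ z ∈ disc, 0 ≤ u z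
  le_polarPoisson : ∀ ρ s θ : ℝ, 0 ≤ ρ → ρ < s → s < 1 →
    u (circleMap 0 ρ θ) ≤ polarPoisson (ρ / s) (fun η => u (circleMap 0 s η)) θ

namespace PoissonDominated

variable {u : ℂ → ℝ}

theorem integral_sub_sq_le (hu : PoissonDominated u) {ρ s : ℝ} (h0 : 0 ≤ ρ) (hρs : ρ < s)
    (hs : s < 1) :
    ∫ θ, (u (circleMap 0 s θ) - u (circleMap 0 ρ θ)) ^ 2 ∂arcMeasure ≤
      4 * (∫ θ, u (circleMap 0 s θ) ^ 2 ∂arcMeasure -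
        ∫ θ, u (circleMap 0 ρ θ) ^ 2 ∂arcMeasure) :=
  have hs0 : 0 < s := h0.trans_lt hρs
  integral_sub_sq_le_of_le_polarPoisson (div_nonneg h0 hs0.le) ((div_lt_one hs0).2 hρs)
    (hu.continuousOn.continuous_circleMap_of_disc hs0.le hs)
    (hu.continuousOn.continuous_circleMap_of_disc h0 (hρs.trans hs))
    (fun θ => hu.nonneg _ (circleMap_mem_disc h0 (hρs.trans hs) θ))
    (fun θ => hu.le_polarPoisson ρ s θ h0 hρs hs)

theorem monotoneOn (hu : PoissonDominated u) :
    MonotoneOn (fun r => ∫ θ, u (circleMap 0 r θ) ^ 2 ∂arcMeasure) (Ico 0 1) := by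
  intro ρ hρ s hs hρs
  rcases hρs.lt_or_eq with h | rfl
  · have h1 := hu.integral_sub_sq_le hρ.1 h hs.2
    have h2 : 0 ≤ ∫ θ, (u (circleMap 0 s θ) - u (circleMap 0 ρ θ)) ^ 2 ∂arcMeasure :=
      integral_nonneg fun θ => sq_nonneg _
    simp only
    linarith
  · exact le_rfl

end PoissonDominated

theorem norm_sq_Lp_two {μ : Measure ℝ} (F : Lp ℝ 2 μ) : ‖F‖ ^ 2 = ∫ θ, (F θ) ^ 2 ∂μ := by
  rw [← real_inner_self_eq_norm_sq, L2.inner_def]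
  congr 1; ext θ; simp [sq]

/-- The radial functions of a Poisson dominated function with bounded quadratic means converge
in `L²` of the circle. -/
theorem PoissonDominated.exists_boundary {u : ℂ → ℝ} (hu : PoissonDominated u)
    (hb : ∃ C, ∀ r ∈ Ioo (0 : ℝ) 1, ∫ θ, u (circleMap 0 r θ) ^ 2 ∂arcMeasure ≤ C) :
    ∃ φ : ℝ → ℝ, MemLp φ 2 arcMeasure ∧
      Tendsto (fun r : ℝ => eLpNorm (fun θ => u (circleMap 0 r θ) - φ θ) 2 arcMeasure)
        (𝓝[<] 1) (𝓝 0) ∧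
      Tendsto (fun r : ℝ => ∫ θ, u (circleMap 0 r θ) ^ 2 ∂arcMeasure) (𝓝[<] 1)
        (𝓝 (∫ θ, φ θ ^ 2 ∂arcMeasure)) := by
  obtain ⟨C, hC⟩ := hb
  have hmem : ∀ r ∈ Ico (0 : ℝ) 1, MemLp (fun θ => u (circleMap 0 r θ)) 2 arcMeasure := by
    intro r hr
    have hc := hu.continuousOn.continuous_circleMap_of_disc hr.1 hr.2
    rw [memLp_two_iff_integrable_sq hc.aestronglyMeasurable]
    exact (hc.pow 2).integrable_arcMeasure
  set m : ℝ → ℝ := fun r => ∫ θ, u (circleMap 0 r θ) ^ 2 ∂arcMeasure with hm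
  classical
  let V : ℝ → Lp ℝ 2 arcMeasure := fun r =>
    if h : r ∈ Ico (0 : ℝ) 1 then (hmem r h).toLp _ else 0
  have hV : ∀ r ∈ Ico (0 : ℝ) 1, V r =ᵐ[arcMeasure] fun θ => u (circleMap 0 r θ) := by
    intro r hr
    simp only [V, hr, dite_true]
    exact MemLp.coeFn_toLp _
  have hVn : ∀ r ∈ Ico (0 : ℝ) 1, ‖V r‖ ^ 2 = m r := by
    intro r hr
    rw [norm_sq_Lp_two]
    refine integral_congr_ae ?_
    filter_upwards [hV r hr] with θ h
    rw [h]
  have hVd : ∀ ρ ∈ Ico (0 : ℝ) 1, ∀ s ∈ Ico (0 : ℝ) 1, ρ ≤ s →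
      ‖V s - V ρ‖ ^ 2 ≤ 4 * (m s - m ρ) := by
    intro ρ hρ s hs h
    rcases h.lt_or_eq with h | rfl
    · rw [norm_sq_Lp_two]
      refine le_trans (le_of_eq (integral_congr_ae ?_)) (hu.integral_sub_sq_le hρ.1 h hs.2)
      filter_upwards [hV s hs, hV ρ hρ, Lp.coeFn_sub (V s) (V ρ)] with θ h1 h2 h3
      rw [h3, Pi.sub_apply, h1, h2]
    · simp
  -- The means increase and are bounded, and their increments control the squared distances.
  have hcauchy : Cauchy (map V (𝓝[<] 1)) := by
    rw [Metric.cauchy_iff]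
    refine ⟨inferInstance, fun ε hε => ?_⟩
    -- choose a radius nearly attaining the supremum of the means
    have hbdd : BddAbove (m '' Ioo 0 1) := ⟨C, by rintro _ ⟨r, hr, rfl⟩; exact hC r hr⟩
    obtain ⟨_, ⟨r0, hr0, rfl⟩, hlt⟩ := exists_lt_of_lt_csSup
      (s := m '' Ioo 0 1) ⟨_, 1 / 2, by norm_num, rfl⟩
      (sub_lt_self (sSup (m '' Ioo 0 1)) (by positivity : (0 : ℝ) < (ε / 8) ^ 2))
    have key : ∀ s ∈ Ico r0 1, ‖V s - V r0‖ < ε / 2 := by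
      intro s hs
      have hs' : s ∈ Ioo (0 : ℝ) 1 := ⟨hr0.1.trans_le hs.1, hs.2⟩
      have h1 := hVd r0 ⟨hr0.1.le, hr0.2⟩ s ⟨hs'.1.le, hs.2⟩ hs.1
      have h2 : m s ≤ sSup (m '' Ioo 0 1) := le_csSup hbdd ⟨s, hs', rfl⟩
      have h3 : ‖V s - V r0‖ ^ 2 < (ε / 2) ^ 2 := by nlinarith
      exact lt_of_pow_lt_pow_left₀ 2 (by positivity) h3
    refine ⟨V '' Ico r0 1, image_mem_map ?_, ?_⟩
    · filter_upwards [Ioo_mem_nhdsLT hr0.2] with s hs using ⟨hs.1.le, hs.2⟩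
    · rintro _ ⟨s, hs, rfl⟩ _ ⟨t, ht, rfl⟩
      calc dist (V s) (V t) ≤ dist (V s) (V r0) + dist (V t) (V r0) := dist_triangle_right _ _ _
        _ < ε / 2 + ε / 2 := by
          rw [dist_eq_norm, dist_eq_norm]; exact add_lt_add (key s hs) (key t ht)
        _ = ε := by ring
  obtain ⟨Φ, hΦ⟩ := cauchy_map_iff_exists_tendsto.1 hcauchy
  have hev : ∀ᶠ r in 𝓝[<] (1 : ℝ), r ∈ Ico (0 : ℝ) 1 := by
    filter_upwards [Ioo_mem_nhdsLT (zero_lt_one' ℝ)] with s hs using ⟨hs.1.le, hs.2⟩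
  refine ⟨Φ, Lp.memLp Φ, ?_, ?_⟩
  · refine ((Lp.tendsto_Lp_iff_tendsto_eLpNorm' V Φ).1 hΦ).congr' ?_
    filter_upwards [hev] with r hr
    refine eLpNorm_congr_ae ?_
    filter_upwards [hV r hr] with θ h
    rw [Pi.sub_apply, h]
  · rw [← norm_sq_Lp_two]
    refine (hΦ.norm.pow 2).congr' ?_
    filter_upwards [hev] with r hr using hVn r hr

theorem exists_seq_tendsto_ae_of_eLpNorm {F : ℝ → ℝ → ℝ} {φ : ℝ → ℝ}
    (hF : ∀ r ∈ Ioo (0 : ℝ) 1, Continuous (F r)) (hφ : MemLp φ 2 arcMeasure)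
    (h : Tendsto (fun r : ℝ => eLpNorm (fun θ => F r θ - φ θ) 2 arcMeasure) (𝓝[<] 1) (𝓝 0)) :
    ∃ r : ℕ → ℝ, (∀ n, r n ∈ Ioo (0 : ℝ) 1) ∧ Tendsto r atTop (𝓝[<] 1) ∧
      ∀ᵐ θ ∂arcMeasure, Tendsto (fun n => F (r n) θ) atTop (𝓝 (φ θ)) := by
  obtain ⟨a, -, ha, ha1⟩ := exists_seq_strictMono_tendsto' (zero_lt_one' ℝ)
  have ha' : Tendsto a atTop (𝓝[<] 1) :=
    tendsto_nhdsWithin_iff.2 ⟨ha1, .of_forall fun n => (ha n).2⟩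
  have hm : TendstoInMeasure arcMeasure (fun n => F (a n)) atTop φ :=
    tendstoInMeasure_of_tendsto_eLpNorm two_ne_zero
      (fun n => (hF _ (ha n)).aestronglyMeasurable) hφ.aestronglyMeasurable (h.comp ha')
  obtain ⟨ns, hns, hae⟩ := hm.exists_seq_tendsto_ae
  exact ⟨a ∘ ns, fun n => ha _, ha'.comp hns.tendsto_atTop, hae⟩

/-- Fatou's lemma for nonnegative functions with bounded integrals. -/
theorem integrable_and_integral_le_of_tendsto_ae {μ : Measure ℝ} {h : ℕ → ℝ → ℝ} {g : ℝ → ℝ}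
    {c : ℕ → ℝ} {C : ℝ} (hi : ∀ n, Integrable (h n) μ) (h0 : ∀ n, 0 ≤ᵐ[μ] h n)
    (hle : ∀ᶠ n in atTop, ∫ θ, h n θ ∂μ ≤ c n) (hc : Tendsto c atTop (𝓝 C))
    (hlim : ∀ᵐ θ ∂μ, Tendsto (fun n => h n θ) atTop (𝓝 (g θ))) :
    Integrable g μ ∧ ∫ θ, g θ ∂μ ≤ C := by
  have hg0 : 0 ≤ᵐ[μ] g := by
    filter_upwards [hlim, ae_all_iff.2 h0] with θ h1 h2
    exact ge_of_tendsto' h1 h2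
  have hgm : AEStronglyMeasurable g μ :=
    aestronglyMeasurable_of_tendsto_ae atTop (fun n => (hi n).aestronglyMeasurable) hlim
  have hC : 0 ≤ C := ge_of_tendsto hc (hle.mono fun n hn => (integral_nonneg_of_ae (h0 n)).trans hn)
  have hF : ∫⁻ θ, ENNReal.ofReal (g θ) ∂μ ≤ ENNReal.ofReal C := by
    calc ∫⁻ θ, ENNReal.ofReal (g θ) ∂μ
        = ∫⁻ θ, liminf (fun n => ENNReal.ofReal (h n θ)) atTop ∂μ := by
          refine lintegral_congr_ae ?_
          filter_upwards [hlim] with θ h1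
          exact (((ENNReal.continuous_ofReal.tendsto _).comp h1).liminf_eq).symm
      _ ≤ liminf (fun n => ∫⁻ θ, ENNReal.ofReal (h n θ) ∂μ) atTop :=
          lintegral_liminf_le' fun n => (hi n).aestronglyMeasurable.aemeasurable.ennreal_ofReal
      _ ≤ liminf (fun n => ENNReal.ofReal (c n)) atTop := by
          refine liminf_le_liminf (hle.mono fun n hn => ?_)
          rw [← ofReal_integral_eq_lintegral_ofReal (hi n) (h0 n)]
          exact ENNReal.ofReal_le_ofReal hn
      _ = ENNReal.ofReal C := ((ENNReal.continuous_ofReal.tendsto _).comp hc).liminf_eq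
  have hint : Integrable g μ :=
    (lintegral_ofReal_ne_top_iff_integrable hgm hg0).1 (hF.trans_lt ENNReal.ofReal_lt_top).ne
  refine ⟨hint, ?_⟩
  rw [← ofReal_integral_eq_lintegral_ofReal hint hg0] at hF
  exact (ENNReal.ofReal_le_ofReal_iff hC).1 hF

/-! ### Integral means of Hardy functions. -/

section HardyMeans

variable {f : ℂ → ℂ} {p : ℝ}

theorem DifferentiableOn.analyticOnNhd_closedBall_of_disc (hf : DifferentiableOn ℂ f disc) {R : ℝ}
    (hR : R < 1) : AnalyticOnNhd ℂ f (Metric.closedBall 0 R) :=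
  (hf.analyticOnNhd Metric.isOpen_ball).mono (Metric.closedBall_subset_ball hR)

theorem poissonDominated_norm_rpow (hf : DifferentiableOn ℂ f disc) {q : ℝ} (hq : 0 < q) :
    PoissonDominated fun z => ‖f z‖ ^ q where
  continuousOn := hf.continuousOn.norm.rpow_const fun _ _ => Or.inr hq.le
  nonneg := fun _ _ => by positivity
  le_polarPoisson := fun ρ s θ h0 h1 h2 =>
    norm_rpow_le_polarPoisson hq (by rwa [abs_of_nonneg h0])
      (hf.analyticOnNhd_closedBall_of_disc h2) θ

theorem meanPow_eq (p : ℝ) (f : ℂ → ℂ) (r : ℝ) :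
    meanPow p f r = ∫ θ, ‖f (circleMap 0 r θ)‖ ^ p ∂arcMeasure :=
  circleAverage_eq_arcMeasure _ r

/-- Passing to `|f|^{p/2}` reduces every `p > 0` to the quadratic case. -/
theorem sq_rpow_half (p : ℝ) (z : ℂ) : (‖z‖ ^ (p / 2)) ^ 2 = ‖z‖ ^ p := by
  rw [← Real.rpow_natCast, ← Real.rpow_mul (norm_nonneg z)]
  norm_num

theorem meanPow_eq_sq (p : ℝ) (f : ℂ → ℂ) (r : ℝ) :
    meanPow p f r = ∫ θ, (‖f (circleMap 0 r θ)‖ ^ (p / 2)) ^ 2 ∂arcMeasure := by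
  simp_rw [meanPow_eq, sq_rpow_half]

theorem monotoneOn_meanPow (hf : DifferentiableOn ℂ f disc) (hp : 0 < p) :
    MonotoneOn (meanPow p f) (Ico 0 1) := by
  simpa only [← meanPow_eq_sq] using (poissonDominated_norm_rpow hf (half_pos hp)).monotoneOn

theorem continuous_norm_rpow_circleMap (hf : DifferentiableOn ℂ f disc) (hp : 0 < p) {r : ℝ}
    (h0 : 0 ≤ r) (h1 : r < 1) : Continuous fun θ => ‖f (circleMap 0 r θ)‖ ^ p :=
  (hf.continuousOn.continuous_circleMap_of_disc h0 h1).norm.rpow_const fun _ => Or.inr hp.le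

theorem meanPow_zero (p : ℝ) (f : ℂ → ℂ) : meanPow p f 0 = ‖f 0‖ ^ p := by
  simp [meanPow_eq]

/-- The radial limit function of `|f|^{p/2}` for `f` in the Hardy space. -/
theorem MemHardy.exists_boundary (hp : 0 < p) (hf : MemHardy p f) :
    ∃ φ : ℝ → ℝ, MemLp φ 2 arcMeasure ∧
      Tendsto (fun r : ℝ => eLpNorm (fun θ => ‖f (circleMap 0 r θ)‖ ^ (p / 2) - φ θ) 2 arcMeasure)
        (𝓝[<] 1) (𝓝 0) ∧
      Tendsto (meanPow p f) (𝓝[<] 1) (𝓝 (∫ θ, φ θ ^ 2 ∂arcMeasure)) := by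
  obtain ⟨C, hC⟩ := hf.2
  have := (poissonDominated_norm_rpow hf.1 (half_pos hp)).exists_boundary
    ⟨C, fun r hr => by rw [← meanPow_eq_sq]; exact hC r hr⟩
  simpa only [← meanPow_eq_sq] using this

theorem ae_arcMeasure_of_ae {q : ℝ → Prop} (h : ∀ᵐ θ, q θ) : ∀ᵐ θ ∂arcMeasure, q θ :=
  ae_arcMeasure_iff.2 (ae_restrict_of_ae h)

theorem meanPow_le_of_tendsto (hf : DifferentiableOn ℂ f disc) (hp : 0 < p) {A : ℝ}
    (h : Tendsto (meanPow p f) (𝓝[<] 1) (𝓝 A)) {r : ℝ} (h0 : 0 ≤ r) (h1 : r < 1) :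
    meanPow p f r ≤ A := by
  refine ge_of_tendsto h ?_
  filter_upwards [Ioo_mem_nhdsLT h1] with s hs
  exact monotoneOn_meanPow hf hp ⟨h0, h1⟩ ⟨h0.trans hs.1.le, hs.2⟩ hs.1.le

/-- Multiplication by an inner function does not change the limit of the integral means. -/
theorem exists_tendsto_meanPow_of_isHardyQuotient (hp : 0 < p) {I g : ℂ → ℂ} (hI : IsInner I)
    (hg : IsHardyQuotient p f I g) (hf : DifferentiableOn ℂ f disc) :
    ∃ A, Tendsto (meanPow p f) (𝓝[<] 1) (𝓝 A) ∧ Tendsto (meanPow p g) (𝓝[<] 1) (𝓝 A) := by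
  obtain ⟨φ, hφ, hL, hA⟩ := hg.1.exists_boundary hp
  refine ⟨_, ?_, hA⟩
  have hfact : ∀ z ∈ disc, ‖f z‖ ^ p = ‖I z‖ ^ p * ‖g z‖ ^ p := by
    intro z hz
    rw [hg.2 z hz, norm_mul, Real.mul_rpow (norm_nonneg _) (norm_nonneg _)]
  have hle : ∀ r ∈ Ioo (0 : ℝ) 1, meanPow p f r ≤ meanPow p g r := by
    intro r hr
    rw [meanPow_eq, meanPow_eq]
    refine integral_mono
      (continuous_norm_rpow_circleMap hf hp hr.1.le hr.2).integrable_arcMeasure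
      (continuous_norm_rpow_circleMap hg.1.1 hp hr.1.le hr.2).integrable_arcMeasure fun θ => ?_
    have hz := circleMap_mem_disc hr.1.le hr.2 θ
    simp only
    rw [hfact _ hz]
    exact mul_le_of_le_one_left (by positivity)
      (Real.rpow_le_one (norm_nonneg _) (hI.2.1 _ hz) hp.le)
  have hfH : MemHardy p f :=
    ⟨hf, by obtain ⟨C, hC⟩ := hg.1.2; exact ⟨C, fun r hr => (hle r hr).trans (hC r hr)⟩⟩
  obtain ⟨ψ, -, -, hB⟩ := hfH.exists_boundary hp
  have hBA : ∫ θ, ψ θ ^ 2 ∂arcMeasure ≤ ∫ θ, φ θ ^ 2 ∂arcMeasure := by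
    refine le_of_tendsto_of_tendsto hB hA ?_
    filter_upwards [Ioo_mem_nhdsLT (zero_lt_one' ℝ)] with r hr using hle r hr
  -- Reverse inequality: along a sequence of radii `|f|^p = |I|^p |g|^p` tends to `φ²` almost
  -- everywhere, so Fatou's lemma bounds `∫ φ²` by the limit of the means of `f`.
  obtain ⟨r, hr, hr1, hae⟩ := exists_seq_tendsto_ae_of_eLpNorm
    (fun r hr => continuous_norm_rpow_circleMap hg.1.1 (half_pos hp) hr.1.le hr.2) hφ hL
  have hAB := (integrable_and_integral_le_of_tendsto_ae (μ := arcMeasure) (g := fun θ => φ θ ^ 2)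
    (h := fun n θ => ‖f (circleMap 0 (r n) θ)‖ ^ p) (c := fun n => meanPow p f (r n))
    (fun n => (continuous_norm_rpow_circleMap hf hp (hr n).1.le (hr n).2).integrable_arcMeasure)
    (fun n => .of_forall fun θ => by simp only [Pi.zero_apply]; positivity)
    (.of_forall fun n => (meanPow_eq p f (r n)).ge) (hB.comp hr1) (by
      filter_upwards [hae, ae_arcMeasure_of_ae hI.2.2] with θ h1 ⟨w, hw, h2⟩
      have h3 : Tendsto (fun n => ‖I (circleMap 0 (r n) θ)‖ ^ p *
          (‖g (circleMap 0 (r n) θ)‖ ^ (p / 2)) ^ 2) atTop (𝓝 (‖w‖ ^ p * φ θ ^ 2)) :=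
        ((h2.comp hr1).norm.rpow_const (Or.inr hp.le)).mul (h1.pow 2)
      rw [hw, Real.one_rpow, one_mul] at h3
      refine h3.congr fun n => ?_
      rw [sq_rpow_half, hfact _ (circleMap_mem_disc (hr n).1.le (hr n).2 θ)])).2
  rwa [le_antisymm hBA hAB] at hB

end HardyMeans

/-! ### Differentiating the integral means. -/

section MeanDerivative

variable {f : ℂ → ℂ} {p : ℝ}

theorem hasDerivAt_norm_rpow_circleMap (hf : DifferentiableOn ℂ f disc) {r θ : ℝ} (h0 : 0 ≤ r)
    (h1 : r < 1) (hne : f (circleMap 0 r θ) ≠ 0) :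
    HasDerivAt (fun r : ℝ => (‖f (circleMap 0 r θ)‖ ^ 2) ^ (p / 2))
      (2 * inner ℝ (f (circleMap 0 r θ)) (deriv f (circleMap 0 r θ) * circleMap 0 1 θ) * (p / 2) *
        (‖f (circleMap 0 r θ)‖ ^ 2) ^ (p / 2 - 1)) r := by
  have hd : HasDerivAt f (deriv f (circleMap 0 r θ)) (circleMap 0 r θ) :=
    (hf.differentiableAt (Metric.isOpen_ball.mem_nhds (circleMap_mem_disc h0 h1 θ))).hasDerivAt
  have hc : HasDerivAt (fun r : ℝ => circleMap 0 r θ) (circleMap 0 1 θ) r := by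
    simp only [circleMap, zero_add, Complex.ofReal_one, one_mul]
    simpa using (Complex.ofRealCLM.hasDerivAt (x := r)).mul_const (Complex.exp (θ * Complex.I))
  have hn := (hd.comp r hc).norm_sq.rpow_const (p := p / 2)
    (Or.inl (pow_ne_zero 2 (norm_ne_zero_iff.2 hne)))
  exact hn

/-- The zeros in a slightly larger closed disc form a compact set, so circles near a zero-free one
are zero-free. There `|f|^p` has a continuous radial derivative, and differentiation under the
integral is legitimate. -/
theorem differentiableAt_meanPow (hf : DifferentiableOn ℂ f disc) (hp : 0 < p) {r₀ : ℝ}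
    (hr : r₀ ∈ Ioo (0 : ℝ) 1) (hne : ∀ θ, f (circleMap 0 r₀ θ) ≠ 0) :
    DifferentiableAt ℝ (meanPow p f) r₀ := by
  set R := (1 + r₀) / 2 with hR
  have hR1 : R < 1 := by linarith [hr.2]
  have hrR : r₀ < R := by linarith [hr.2]
  have hRd : Metric.closedBall (0 : ℂ) R ⊆ disc := Metric.closedBall_subset_ball hR1
  have hK : IsCompact (Metric.closedBall (0 : ℂ) R ∩ f ⁻¹' {0}) :=
    (isCompact_closedBall 0 R).of_isClosed_subset
      ((hf.continuousOn.mono hRd).preimage_isClosed_of_isClosed Metric.isClosed_closedBall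
        isClosed_singleton) inter_subset_left
  have hN : ((fun z : ℂ => ‖z‖) '' (Metric.closedBall 0 R ∩ f ⁻¹' {0}))ᶜ ∈ 𝓝 r₀ := by
    refine (hK.image continuous_norm).isClosed.isOpen_compl.mem_nhds ?_
    rintro ⟨z, ⟨-, hz⟩, hzr⟩
    apply hne z.arg
    have : circleMap 0 r₀ z.arg = z := by
      simp only at hzr
      rw [← hzr, circleMap, zero_add, Complex.norm_mul_exp_arg_mul_I]
    rw [this]; exact hz
  obtain ⟨ε, hε, hsub⟩ := Metric.nhds_basis_closedBall.mem_iff.1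
    (inter_mem hN (Ioo_mem_nhds hr.1 hrR))
  rw [Real.closedBall_eq_Icc] at hsub
  set S := Icc (r₀ - ε) (r₀ + ε) with hS
  have hSI : ∀ r ∈ S, r ∈ Ioo 0 R := fun r hr => (hsub hr).2
  have hSne : ∀ r ∈ S, ∀ θ, f (circleMap 0 r θ) ≠ 0 := by
    intro r hr θ h
    refine (hsub hr).1 ⟨circleMap 0 r θ, ⟨?_, h⟩, ?_⟩
    · simpa [abs_of_pos (hSI r hr).1] using (hSI r hr).2.le
    · simp [abs_of_pos (hSI r hr).1]
  have hSd : ∀ x ∈ S ×ˢ (univ : Set ℝ), circleMap 0 x.1 x.2 ∈ disc := fun x hx =>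
    circleMap_mem_disc (hSI _ hx.1).1.le ((hSI _ hx.1).2.trans hR1) _
  set F' : ℝ → ℝ → ℝ := fun r θ =>
    2 * inner ℝ (f (circleMap 0 r θ)) (deriv f (circleMap 0 r θ) * circleMap 0 1 θ) * (p / 2) *
        (‖f (circleMap 0 r θ)‖ ^ 2) ^ (p / 2 - 1) with hF'
  have hcm : Continuous fun x : ℝ × ℝ => circleMap 0 x.1 x.2 := by
    unfold circleMap; fun_prop
  have hF'c : ContinuousOn (fun x : ℝ × ℝ => F' x.1 x.2) (S ×ˢ univ) := by
    have c1 : ContinuousOn (fun x : ℝ × ℝ => f (circleMap 0 x.1 x.2)) (S ×ˢ univ) :=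
      hf.continuousOn.comp hcm.continuousOn hSd
    have c2 : ContinuousOn (fun x : ℝ × ℝ => deriv f (circleMap 0 x.1 x.2)) (S ×ˢ univ) :=
      (hf.deriv Metric.isOpen_ball).continuousOn.comp hcm.continuousOn hSd
    have c3 : Continuous fun x : ℝ × ℝ => circleMap 0 1 x.2 :=
      (continuous_circleMap 0 1).comp continuous_snd
    refine ContinuousOn.mul ?_ ((c1.norm.pow 2).rpow_const fun x hx =>
      Or.inl (pow_ne_zero 2 (norm_ne_zero_iff.2 (hSne _ hx.1 _))))
    exact (continuousOn_const.mul (ContinuousOn.inner (𝕜 := ℝ) c1 (c2.mul c3.continuousOn))).mul continuousOn_const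
  obtain ⟨C, hC⟩ := ((isCompact_Icc (a := r₀ - ε) (b := r₀ + ε)).prod
    (isCompact_Icc (a := (0 : ℝ)) (b := 2 * Real.pi))).exists_bound_of_continuousOn
    (hF'c.mono (prod_mono le_rfl (subset_univ _)))
  have hSn : S ∈ 𝓝 r₀ := Icc_mem_nhds (by linarith) (by linarith)
  have hGc : ∀ r ∈ S, Continuous fun θ => (‖f (circleMap 0 r θ)‖ ^ 2) ^ (p / 2) := by
    intro r hr
    have c1 := hf.continuousOn.continuous_circleMap_of_disc (hSI r hr).1.le
      ((hSI r hr).2.trans hR1)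
    exact (c1.norm.pow 2).rpow_const fun _ => Or.inr (half_pos hp).le
  have hderiv := (intervalIntegral.hasDerivAt_integral_of_dominated_loc_of_deriv_le
    (F := fun r θ => (‖f (circleMap 0 r θ)‖ ^ 2) ^ (p / 2)) (F' := F') (x₀ := r₀)
    (bound := fun _ => C) (a := 0) (b := 2 * Real.pi) (μ := volume) hSn
    (by filter_upwards [hSn] with r hr using (hGc r hr).aestronglyMeasurable)
    ((hGc r₀ (mem_of_mem_nhds hSn)).intervalIntegrable _ _)
    (Continuous.aestronglyMeasurable (by
      rw [← continuousOn_univ]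
      exact hF'c.comp (f := fun θ : ℝ => (r₀, θ)) (by fun_prop)
        fun θ _ => ⟨mem_of_mem_nhds hSn, mem_univ _⟩))
    (.of_forall fun θ hθ r hr => hC (r, θ) ⟨hr, by
      rw [uIoc_of_le (by positivity)] at hθ
      exact Ioc_subset_Icc_self hθ⟩)
    (by simp)
    (.of_forall fun θ _ r hr => hasDerivAt_norm_rpow_circleMap hf (hSI r hr).1.le
      ((hSI r hr).2.trans hR1) (hSne r hr θ))).2
  have heq : meanPow p f = fun r => (2 * Real.pi)⁻¹ *
      ∫ θ in (0 : ℝ)..(2 * Real.pi), (‖f (circleMap 0 r θ)‖ ^ 2) ^ (p / 2) := by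
    ext r
    rw [meanPow_eq, arcMeasure_integral]
    congr 2; ext θ
    rw [← Real.rpow_natCast, ← Real.rpow_mul (norm_nonneg _), Nat.cast_ofNat,
      mul_div_cancel₀ _ two_ne_zero]
  rw [heq]
  exact (hderiv.const_mul _).differentiableAt

/-- The radii of circles carrying zeros of `f`. -/
def zeroRadii (f : ℂ → ℂ) : Set ℝ := (fun z : ℂ => ‖z‖) '' {z | z ∈ disc ∧ f z = 0}

theorem countable_zeros (hf : DifferentiableOn ℂ f disc) (hf0 : ∃ z ∈ disc, f z ≠ 0) :
    {z | z ∈ disc ∧ f z = 0}.Countable := by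
  obtain ⟨z₀, hz₀, hfz₀⟩ := hf0
  have hz₀' : ‖z₀‖ < 1 := by simpa [disc] using hz₀
  obtain ⟨a, -, ha, ha1⟩ := exists_seq_strictMono_tendsto' hz₀'
  have hfin : ∀ n, {z : ℂ | ‖z‖ ≤ a n ∧ f z = 0}.Countable := by
    intro n
    obtain ⟨s, m, g, -, -, hg0, hfg⟩ :=
      (hf.analyticOnNhd_closedBall_of_disc (ha n).2).exists_eq_prod_sub_pow_mul
        ((norm_nonneg z₀).trans_lt (ha n).1) ⟨z₀, by simpa using (ha n).1.le, hfz₀⟩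
    refine s.finite_toSet.countable.mono ?_
    rintro z ⟨hz, hfz⟩
    have hz' : z ∈ Metric.closedBall (0 : ℂ) (a n) := by simpa using hz
    rw [hfg z hz', mul_eq_zero, or_iff_left (hg0 z hz'), Finset.prod_eq_zero_iff] at hfz
    obtain ⟨b, hb, h⟩ := hfz
    rw [sub_eq_zero.1 (eq_zero_of_pow_eq_zero h)]
    exact hb
  refine (countable_iUnion hfin).mono ?_
  rintro z ⟨hz, hfz⟩
  obtain ⟨n, hn⟩ := (ha1.eventually (lt_mem_nhds (show ‖z‖ < 1 by simpa [disc] using hz))).exists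
  exact mem_iUnion.2 ⟨n, hn.le, hfz⟩

theorem countable_zeroRadii (hf : DifferentiableOn ℂ f disc) (hf0 : ∃ z ∈ disc, f z ≠ 0) :
    (zeroRadii f).Countable :=
  (countable_zeros hf hf0).image _

theorem ne_zero_of_notMem_zeroRadii {r : ℝ} (h0 : 0 ≤ r) (h1 : r < 1) (hr : r ∉ zeroRadii f)
    (θ : ℝ) : f (circleMap 0 r θ) ≠ 0 := fun h =>
  hr ⟨circleMap 0 r θ, ⟨circleMap_mem_disc h0 h1 θ, h⟩, by simp [abs_of_nonneg h0]⟩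

theorem continuousOn_meanPow (hf : DifferentiableOn ℂ f disc) (hp : 0 < p) :
    ContinuousOn (meanPow p f) (Ico 0 1) := by
  refine Real.ContinuousOn.circleAverage ?_ fun r hr => hr.1
  refine (hf.continuousOn.norm.rpow_const fun _ _ => Or.inr hp.le).mono ?_
  intro z hz
  simpa [disc] using hz.2

theorem intervalIntegrable_deriv_meanPow (hf : DifferentiableOn ℂ f disc) (hp : 0 < p) {a b : ℝ}
    (ha : 0 ≤ a) (hab : a ≤ b) (hb : b < 1) :
    IntervalIntegrable (deriv (meanPow p f)) volume a b := by
  refine MonotoneOn.intervalIntegrable_deriv ?_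
  rw [uIcc_of_le hab]
  exact (monotoneOn_meanPow hf hp).mono fun x hx => ⟨ha.trans hx.1, hx.2.trans_lt hb⟩

/-- Differentiability may fail at countably many radii, which is harmless for a continuous function
with integrable derivative; integrability comes from monotonicity. -/
theorem integral_deriv_meanPow (hf : DifferentiableOn ℂ f disc) (hf0 : ∃ z ∈ disc, f z ≠ 0)
    (hp : 0 < p) {a b : ℝ} (ha : 0 ≤ a) (hab : a ≤ b) (hb : b < 1) :
    ∫ r in a..b, deriv (meanPow p f) r = meanPow p f b - meanPow p f a := by
  refine integral_eq_of_hasDerivAt_off_countable_of_le _ _ hab (countable_zeroRadii hf hf0)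
    ((continuousOn_meanPow hf hp).mono fun x hx => ⟨ha.trans hx.1, hx.2.trans_lt hb⟩) ?_
    (intervalIntegrable_deriv_meanPow hf hp ha hab hb)
  rintro x ⟨hx, hxz⟩
  have h0 : 0 < x := ha.trans_lt hx.1
  have h1 : x < 1 := hx.2.trans hb
  exact (differentiableAt_meanPow hf hp ⟨h0, h1⟩
    (ne_zero_of_notMem_zeroRadii h0.le h1 hxz)).hasDerivAt

theorem deriv_meanPow_nonneg (hf : DifferentiableOn ℂ f disc) (hp : 0 < p) {r : ℝ}
    (hr : r ∈ Ioo (0 : ℝ) 1) : 0 ≤ deriv (meanPow p f) r := by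
  rw [← derivWithin_of_mem_nhds (Ioo_mem_nhds hr.1 hr.2)]
  exact ((monotoneOn_meanPow hf hp).mono Ioo_subset_Ico_self).derivWithin_nonneg

theorem lintegral_deriv_meanPow_Ioc (hf : DifferentiableOn ℂ f disc) (hf0 : ∃ z ∈ disc, f z ≠ 0)
    (hp : 0 < p) {a b : ℝ} (ha : 0 ≤ a) (hab : a ≤ b) (hb : b < 1) :
    ∫⁻ r in Ioc a b, ENNReal.ofReal (deriv (meanPow p f) r) =
      ENNReal.ofReal (meanPow p f b - meanPow p f a) := by
  rw [← integral_deriv_meanPow hf hf0 hp ha hab hb, intervalIntegral.integral_of_le hab,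
    ofReal_integral_eq_lintegral_ofReal]
  · exact (intervalIntegrable_iff_integrableOn_Ioc_of_le hab).1
      (intervalIntegrable_deriv_meanPow hf hp ha hab hb)
  · filter_upwards [ae_restrict_mem measurableSet_Ioc] with r hr
    exact deriv_meanPow_nonneg hf hp ⟨ha.trans_lt hr.1, hr.2.trans_lt hb⟩

theorem lintegral_deriv_meanPow_Ioo (hf : DifferentiableOn ℂ f disc) (hf0 : ∃ z ∈ disc, f z ≠ 0)
    (hp : 0 < p) {A : ℝ} (hA : Tendsto (meanPow p f) (𝓝[<] 1) (𝓝 A)) {t : ℝ} (ht : 0 ≤ t)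
    (ht1 : t < 1) :
    ∫⁻ r in Ioo t 1, ENNReal.ofReal (deriv (meanPow p f) r) =
      ENNReal.ofReal (A - meanPow p f t) := by
  obtain ⟨b, -, hb, hb1⟩ := exists_seq_strictMono_tendsto' ht1
  have hcov := aecover_Ioo_of_Ioc (μ := volume) (a := fun _ : ℕ => t) (b := b) (A := t) (B := 1)
    tendsto_const_nhds hb1
  have h1 := hcov.lintegral_tendsto_of_countably_generated
    (f := fun r => ENNReal.ofReal (deriv (meanPow p f) r))
    (measurable_deriv _).ennreal_ofReal.aemeasurable
  have h2 : Tendsto (fun n => ENNReal.ofReal (meanPow p f (b n) - meanPow p f t)) atTop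
      (𝓝 (ENNReal.ofReal (A - meanPow p f t))) := by
    refine (ENNReal.continuous_ofReal.tendsto _).comp (Tendsto.sub_const (hA.comp ?_) _)
    exact tendsto_nhdsWithin_iff.2 ⟨hb1, .of_forall fun n => (hb n).2⟩
  refine tendsto_nhds_unique h1 (h2.congr fun n => ?_)
  rw [Measure.restrict_restrict measurableSet_Ioc, inter_eq_left.2,
    lintegral_deriv_meanPow_Ioc hf hf0 hp ht (hb n).1.le (hb n).2]
  exact fun x hx => ⟨hx.1, hx.2.trans_lt (hb n).2⟩

end MeanDerivative

/-! ### The norm by parts, and the strict inequality. -/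

section NormFormula

variable {f : ℂ → ℂ} {p α : ℝ}

/-- The derivative of the weight `(1 - r²)^{α-1}`. -/
noncomputable def weightDeriv (α t : ℝ) : ℝ := 2 * (1 - α) * t * (1 - t ^ 2) ^ (α - 2)

theorem one_sub_sq_pos {t : ℝ} (h0 : 0 ≤ t) (h1 : t < 1) : 0 < 1 - t ^ 2 := by nlinarith

theorem weightDeriv_pos (hα : α < 1) {t : ℝ} (ht : t ∈ Ioo (0 : ℝ) 1) : 0 < weightDeriv α t := by
  have h1 := one_sub_sq_pos ht.1.le ht.2
  have h2 := sub_pos.2 hα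
  have h3 := ht.1
  unfold weightDeriv
  positivity

theorem hasDerivAt_weight {t : ℝ} (h0 : 0 ≤ t) (h1 : t < 1) :
    HasDerivAt (fun r : ℝ => (1 - r ^ 2) ^ (α - 1)) (weightDeriv α t) t := by
  have h := (((hasDerivAt_id t).pow 2).const_sub 1).rpow_const (p := α - 1)
    (Or.inl (one_sub_sq_pos h0 h1).ne')
  refine h.congr_deriv ?_
  rw [weightDeriv, show α - 1 - 1 = α - 2 by ring]
  simp
  ring

theorem lintegral_weightDeriv (hα : α < 1) {r : ℝ} (hr : r ∈ Ioo (0 : ℝ) 1) :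
    ∫⁻ t in Ioo 0 r, ENNReal.ofReal (weightDeriv α t) =
      ENNReal.ofReal ((1 - r ^ 2) ^ (α - 1) - 1) := by
  have hc : ContinuousOn (weightDeriv α) (Icc 0 r) := by
    unfold weightDeriv
    refine ContinuousOn.mul (by fun_prop) (ContinuousOn.rpow_const (by fun_prop) fun t ht => ?_)
    exact Or.inl (one_sub_sq_pos ht.1 (ht.2.trans_lt hr.2)).ne'
  have hi : IntervalIntegrable (weightDeriv α) volume 0 r :=
    ContinuousOn.intervalIntegrable (by rwa [uIcc_of_le hr.1.le])
  have h1 : ∫ t in (0 : ℝ)..r, weightDeriv α t = (1 - r ^ 2) ^ (α - 1) - 1 := by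
    rw [intervalIntegral.integral_eq_sub_of_hasDerivAt (f := fun r : ℝ => (1 - r ^ 2) ^ (α - 1))
      (fun t ht => ?_) hi]
    · simp
    · rw [uIcc_of_le hr.1.le] at ht
      exact hasDerivAt_weight ht.1 (ht.2.trans_lt hr.2)
  rw [← h1, intervalIntegral.integral_of_le hr.1.le, integral_Ioc_eq_integral_Ioo,
    ofReal_integral_eq_lintegral_ofReal]
  · exact ((intervalIntegrable_iff_integrableOn_Ioc_of_le hr.1.le).1 hi).mono_set
      Ioo_subset_Ioc_self
  · filter_upwards [ae_restrict_mem measurableSet_Ioo] with t ht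
    exact (weightDeriv_pos hα ⟨ht.1, ht.2.trans hr.2⟩).le

theorem one_le_weight (hα : α < 1) {r : ℝ} (hr : r ∈ Ioo (0 : ℝ) 1) :
    1 ≤ (1 - r ^ 2) ^ (α - 1) :=
  Real.one_le_rpow_of_pos_of_le_one_of_nonpos (one_sub_sq_pos hr.1.le hr.2)
    (by nlinarith [hr.1]) (by linarith)

theorem measurable_weightDeriv : Measurable (weightDeriv α) := by
  unfold weightDeriv
  fun_prop

/-- Integration by parts in the definition of the norm of `A^p_α`. -/
theorem aNormPow_eq (hα : α < 1) (hp : 0 < p) (hf : DifferentiableOn ℂ f disc)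
    (hf0 : ∃ z ∈ disc, f z ≠ 0) {A : ℝ} (hA : Tendsto (meanPow p f) (𝓝[<] 1) (𝓝 A)) :
    aNormPow α p f = ENNReal.ofReal A +
      ∫⁻ t in Ioo (0 : ℝ) 1, ENNReal.ofReal (weightDeriv α t) *
        ENNReal.ofReal (A - meanPow p f t) := by
  set D := fun r => ENNReal.ofReal (deriv (meanPow p f) r) with hD
  set W := fun t => ENNReal.ofReal (weightDeriv α t) with hW
  have hDm : Measurable D := (measurable_deriv _).ennreal_ofReal
  have hWm : Measurable W := measurable_weightDeriv.ennreal_ofReal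
  -- Since `w(0) = 1`, `w(r) = 1 + ∫_0^r w'`. Everything is nonnegative, so Tonelli applies over `t
  -- < r` without assuming the norm finite.
  have hsplit : ∀ r ∈ Ioo (0 : ℝ) 1,
      ENNReal.ofReal (deriv (meanPow p f) r * (1 - r ^ 2) ^ (α - 1)) =
        D r + ∫⁻ t in Ioo (0 : ℝ) 1, D r * (Iio r).indicator W t := by
    intro r hr
    rw [lintegral_const_mul _ (hWm.indicator measurableSet_Iio),
      lintegral_indicator measurableSet_Iio, Measure.restrict_restrict measurableSet_Iio,
      show Iio r ∩ Ioo (0 : ℝ) 1 = Ioo 0 r by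
        ext t; simp only [mem_inter_iff, mem_Iio, mem_Ioo]; grind [hr.2],
      lintegral_weightDeriv hα hr, ← mul_one_add, ← ENNReal.ofReal_one,
      ← ENNReal.ofReal_add zero_le_one (sub_nonneg.2 (one_le_weight hα hr)), add_sub_cancel,
      ENNReal.ofReal_mul (deriv_meanPow_nonneg hf hp hr)]
  have hmeas : Measurable (Function.uncurry fun r t => D r * (Iio r).indicator W t) := by
    refine (hDm.comp measurable_fst).mul ?_
    have : (fun x : ℝ × ℝ => (Iio x.1).indicator W x.2) =
        {x : ℝ × ℝ | x.2 < x.1}.indicator fun x => W x.2 := by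
      ext x; simp [indicator]
    rw [this]
    exact (hWm.comp measurable_snd).indicator (measurableSet_lt measurable_snd measurable_fst)
  have hinner : ∀ t ∈ Ioo (0 : ℝ) 1, ∫⁻ r in Ioo (0 : ℝ) 1, D r * (Iio r).indicator W t =
      W t * ENNReal.ofReal (A - meanPow p f t) := by
    intro t ht
    have h1 : (fun r => D r * (Iio r).indicator W t) = (Ioi t).indicator fun r => W t * D r := by
      ext r
      by_cases h : t < r <;> simp [indicator, h, mul_comm]
    rw [h1, lintegral_indicator measurableSet_Ioi, Measure.restrict_restrict measurableSet_Ioi,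
      show Ioi t ∩ Ioo (0 : ℝ) 1 = Ioo t 1 by
        ext r; simp only [mem_inter_iff, mem_Ioi, mem_Ioo]; grind [ht.1],
      lintegral_const_mul _ hDm, lintegral_deriv_meanPow_Ioo hf hf0 hp hA ht.1.le ht.2]
  have h0 : ‖f 0‖ ^ p ≤ A := by
    rw [← meanPow_zero]
    exact meanPow_le_of_tendsto hf hp hA le_rfl zero_lt_one
  rw [aNormPow, setLIntegral_congr_fun measurableSet_Ioo hsplit, lintegral_add_left hDm,
    lintegral_lintegral_swap hmeas.aemeasurable, setLIntegral_congr_fun measurableSet_Ioo hinner,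
    lintegral_deriv_meanPow_Ioo hf hf0 hp hA le_rfl zero_lt_one, meanPow_zero, ← add_assoc,
    ← ENNReal.ofReal_add (by positivity) (sub_nonneg.2 h0), add_sub_cancel]

/-- The weight is at least 1, so the norm dominates `|f(0)|^p` plus the growth of the mean. -/
theorem memHardy_of_aNormPow_lt_top (hα : α < 1) (hp : 0 < p) (hf : DifferentiableOn ℂ f disc)
    (hf0 : ∃ z ∈ disc, f z ≠ 0) (h : aNormPow α p f < ∞) : MemHardy p f := by
  refine ⟨hf, (aNormPow α p f).toReal, fun r hr => ?_⟩
  rw [← ENNReal.ofReal_le_iff_le_toReal h.ne]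
  have h1 : ENNReal.ofReal (meanPow p f r - meanPow p f 0) ≤
      ∫⁻ r in Ioo (0 : ℝ) 1, ENNReal.ofReal (deriv (meanPow p f) r * (1 - r ^ 2) ^ (α - 1)) := by
    rw [← lintegral_deriv_meanPow_Ioc hf hf0 hp le_rfl hr.1.le hr.2]
    refine (lintegral_mono_set (fun x hx => ⟨hx.1, hx.2.trans_lt hr.2⟩ :
      Ioc 0 r ⊆ Ioo 0 1)).trans (setLIntegral_mono' measurableSet_Ioo fun x hx => ?_)
    exact ENNReal.ofReal_le_ofReal
      (le_mul_of_one_le_right (deriv_meanPow_nonneg hf hp hx) (one_le_weight hα hx))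
  rw [meanPow_zero] at h1
  calc ENNReal.ofReal (meanPow p f r)
      = ENNReal.ofReal (‖f 0‖ ^ p + (meanPow p f r - ‖f 0‖ ^ p)) := by ring_nf
    _ ≤ ENNReal.ofReal (‖f 0‖ ^ p) + ENNReal.ofReal (meanPow p f r - ‖f 0‖ ^ p) :=
        ENNReal.ofReal_add_le
    _ ≤ aNormPow α p f := add_le_add le_rfl h1

theorem aNorm_lt_top_iff (hp : 0 < p) : aNorm α p f < ∞ ↔ aNormPow α p f < ∞ := by
  rw [aNorm, ENNReal.rpow_lt_top_iff_of_pos (by positivity)]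

theorem MemA.memHardy (hα : α < 1) (hp : 0 < p) (hf : MemA α p f)
    (hf0 : ∃ z ∈ disc, f z ≠ 0) : MemHardy p f :=
  memHardy_of_aNormPow_lt_top hα hp hf.1 hf0 ((aNorm_lt_top_iff hp).1 hf.2)

/-- Maximum modulus principle. -/
theorem IsInner.norm_lt_one {I : ℂ → ℂ} (hI : IsInner I) (hn : InnerNontrivial I) {z : ℂ}
    (hz : z ∈ disc) : ‖I z‖ < 1 := by
  refine lt_of_le_of_ne (hI.2.1 z hz) fun h => hn ⟨I z, fun w hw => ?_⟩
  refine Complex.eqOn_of_isPreconnected_of_isMaxOn_norm (convex_ball (0 : ℂ) 1).isPreconnected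
    Metric.isOpen_ball hI.1 hz ?_ hw
  intro w hw
  simpa [h] using hI.2.1 w hw

theorem meanPow_lt_of_nontrivial (hp : 0 < p) (hf : DifferentiableOn ℂ f disc) {I g : ℂ → ℂ}
    (hI : IsInner I) (hn : InnerNontrivial I) (hg : IsHardyQuotient p f I g) {t : ℝ}
    (ht : t ∈ Ioo (0 : ℝ) 1) (hz : t ∉ zeroRadii f) : meanPow p f t < meanPow p g t := by
  rw [meanPow_eq, meanPow_eq, arcMeasure_integral, arcMeasure_integral]
  have hlt : ∀ θ, ‖f (circleMap 0 t θ)‖ ^ p < ‖g (circleMap 0 t θ)‖ ^ p := by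
    intro θ
    have hd := circleMap_mem_disc ht.1.le ht.2 θ
    have hne := ne_zero_of_notMem_zeroRadii ht.1.le ht.2 hz θ
    rw [hg.2 _ hd] at hne ⊢
    refine Real.rpow_lt_rpow (norm_nonneg _) ?_ hp
    rw [norm_mul]
    exact mul_lt_of_lt_one_left (norm_pos_iff.2 (right_ne_zero_of_mul hne)) (hI.norm_lt_one hn hd)
  refine mul_lt_mul_of_pos_left ?_ (by positivity)
  refine intervalIntegral.integral_lt_integral_of_continuousOn_of_le_of_exists_lt
    (by positivity) (continuous_norm_rpow_circleMap hf hp ht.1.le ht.2).continuousOn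
    (continuous_norm_rpow_circleMap hg.1.1 hp ht.1.le ht.2).continuousOn
    (fun θ _ => (hlt θ).le) ⟨0, ⟨le_rfl, by positivity⟩, hlt 0⟩

/-- Dividing out a nontrivial inner factor decreases the norm. -/
theorem aNorm_lt_of_isHardyQuotient (hα : α < 1) (hp : 0 < p) (hf : MemA α p f)
    (hf0 : ∃ z ∈ disc, f z ≠ 0) {I g : ℂ → ℂ} (hI : IsInner I) (hn : InnerNontrivial I)
    (hg : IsHardyQuotient p f I g) : aNorm α p g < aNorm α p f := by
  obtain ⟨A, hAf, hAg⟩ := exists_tendsto_meanPow_of_isHardyQuotient hp hI hg hf.1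
  have hg0 : ∃ z ∈ disc, g z ≠ 0 := by
    obtain ⟨z, hz, hfz⟩ := hf0
    rw [hg.2 z hz] at hfz
    exact ⟨z, hz, right_ne_zero_of_mul hfz⟩
  have hfin := (aNorm_lt_top_iff hp).1 hf.2
  refine ENNReal.rpow_lt_rpow ?_ (by positivity)
  have hlt : ∀ᵐ t ∂volume.restrict (Ioo (0 : ℝ) 1), ENNReal.ofReal (weightDeriv α t) *
      ENNReal.ofReal (A - meanPow p g t) < ENNReal.ofReal (weightDeriv α t) *
        ENNReal.ofReal (A - meanPow p f t) := by
    filter_upwards [ae_restrict_mem measurableSet_Ioo, ae_restrict_of_ae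
      (measure_eq_zero_iff_ae_notMem.1 ((countable_zeroRadii hf.1 hf0).measure_zero volume))]
      with t ht hz
    have h1 := meanPow_lt_of_nontrivial hp hf.1 hI hn hg ht hz
    have h2 := meanPow_le_of_tendsto hg.1.1 hp hAg ht.1.le ht.2
    refine (ENNReal.mul_lt_mul_iff_right (by simpa using weightDeriv_pos hα ht)
      ENNReal.ofReal_ne_top).2 ?_
    exact (ENNReal.ofReal_lt_ofReal_iff (by linarith)).2 (by linarith)
  rw [aNormPow_eq hα hp hf.1 hf0 hAf] at hfin ⊢
  rw [aNormPow_eq hα hp hg.1.1 hg0 hAg]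
  have hfin2 := (ENNReal.add_lt_top.1 hfin).2
  refine ENNReal.add_lt_add_left ENNReal.ofReal_ne_top ?_
  -- Strictness needs the smaller integral finite; it is bounded by that of `f`, finite since `f` is
  -- in `A^p_α`.
  refine lintegral_strict_mono (by simp [Measure.restrict_eq_zero]) ?_ ?_ hlt
  · have : AEMeasurable (meanPow p f) (volume.restrict (Ioo (0 : ℝ) 1)) :=
      (((continuousOn_meanPow hf.1 hp).mono Ioo_subset_Ico_self).aemeasurable measurableSet_Ioo)
    exact measurable_weightDeriv.ennreal_ofReal.aemeasurable.mul
      (this.const_sub A).ennreal_ofReal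
  · exact ((lintegral_mono_ae (hlt.mono fun _ h => h.le)).trans_lt hfin2).ne

end NormFormula

/-! ### Fatou's theorem on radial limits of Poisson integrals. -/

/-- Jordan's inequality on either side of `π/2`. For `y = |x|/2 ≥ π/2` it gives `sin y ≥ (2/π)(d/2)
= d/π`, while the left side is at most `d/(2π²) · 2π`. -/
theorem mul_abs_le_abs_sin_half {d x : ℝ} (hd : 0 < d) (hdπ : d ≤ Real.pi)
    (hx : |x| ≤ 2 * Real.pi - d) : d / (2 * Real.pi ^ 2) * |x| ≤ |Real.sin (x / 2)| := by
  have hπ := Real.pi_pos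
  have h1 : |Real.sin (x / 2)| = Real.sin (|x| / 2) := by
    rw [← abs_of_pos (zero_lt_two' ℝ), ← abs_div, abs_of_pos (zero_lt_two' ℝ)]
    rcases abs_cases (x / 2) with ⟨h, h'⟩ | ⟨h, h'⟩
    · rw [h]
      rw [abs_div, abs_of_pos (zero_lt_two' ℝ)] at h
      exact abs_of_nonneg (Real.sin_nonneg_of_nonneg_of_le_pi h' (by linarith))
    · rw [h, Real.sin_neg]
      rw [abs_div, abs_of_pos (zero_lt_two' ℝ)] at h
      exact abs_of_nonpos (Real.sin_nonpos_of_nonpos_of_neg_pi_le h'.le (by linarith))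
  rw [h1]
  set y := |x| / 2 with hy
  have hy0 : 0 ≤ y := by positivity
  have hxy : |x| = 2 * y := by rw [hy]; ring
  rw [hxy]
  have hyle : y ≤ Real.pi - d / 2 := by linarith
  rcases le_total y (Real.pi / 2) with h | h
  · refine le_trans ?_ (Real.mul_le_sin hy0 h)
    rw [div_mul_eq_mul_div, div_le_iff₀ (by positivity)]
    have : 2 / Real.pi * y * (2 * Real.pi ^ 2) = 2 * Real.pi * (2 * y) := by field_simp
    rw [this]
    exact mul_le_mul_of_nonneg_right (by linarith) (by positivity)
  · have h2 := Real.mul_le_sin (x := Real.pi - y) (by linarith) (by linarith)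
    rw [Real.sin_pi_sub] at h2
    refine le_trans ?_ h2
    rw [div_mul_eq_mul_div, div_le_iff₀ (by positivity)]
    have : 2 / Real.pi * (Real.pi - y) * (2 * Real.pi ^ 2) =
        4 * Real.pi * (Real.pi - y) := by field_simp; ring
    rw [this]
    nlinarith

/-- The denominator is `(1 - t)² + 4t sin²(x/2)`. Differences of angles in a period may approach
`±2π`, where the kernel peaks again; `d` keeps away from there. -/
theorem polarKernel_le {d : ℝ} (hd : 0 < d) (hdπ : d ≤ Real.pi) {t x : ℝ} (ht : 1 / 2 ≤ t)
    (ht1 : t < 1) (hx : |x| ≤ 2 * Real.pi - d) :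
    polarKernel t x ≤ 2 / (d / (2 * Real.pi ^ 2)) ^ 2 * ((1 - t) / ((1 - t) ^ 2 + x ^ 2)) := by
  have hπ := Real.pi_gt_three
  set c := d / (2 * Real.pi ^ 2) with hc
  have hc0 : 0 < c := by positivity
  have hc1 : c ≤ 1 := by
    rw [hc, div_le_one (by positivity)]; nlinarith
  have hs := mul_abs_le_abs_sin_half hd hdπ hx
  rw [← hc] at hs
  have hs2 : c ^ 2 * x ^ 2 ≤ Real.sin (x / 2) ^ 2 := by
    rw [← sq_abs x, ← sq_abs (Real.sin _), ← mul_pow]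
    exact pow_le_pow_left₀ (by positivity) hs 2
  have hcos : Real.cos x = 1 - 2 * Real.sin (x / 2) ^ 2 := by
    have := Real.cos_two_mul (x / 2)
    rw [mul_div_cancel₀ _ two_ne_zero] at this
    rw [this, Real.cos_sq']
    ring
  have hden : c ^ 2 * ((1 - t) ^ 2 + x ^ 2) ≤ 1 - 2 * t * Real.cos x + t ^ 2 := by
    rw [hcos]
    have h1 : c ^ 2 * (1 - t) ^ 2 ≤ (1 - t) ^ 2 :=
      mul_le_of_le_one_left (sq_nonneg _) (pow_le_one₀ hc0.le hc1)
    nlinarith [mul_le_mul_of_nonneg_left hs2 (by linarith : (0 : ℝ) ≤ 4 * t),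
      mul_nonneg (sq_nonneg c) (sq_nonneg x)]
  have hpos : 0 < (1 - t) ^ 2 + x ^ 2 := by
    have : 0 < (1 - t) ^ 2 := pow_pos (by linarith) 2
    positivity
  calc polarKernel t x ≤ (2 * (1 - t)) / (c ^ 2 * ((1 - t) ^ 2 + x ^ 2)) := by
        unfold polarKernel
        refine div_le_div₀ (by linarith) (by nlinarith) (by positivity) hden
    _ = _ := by field_simp

/-- Take the least `j`: if `j = i + 1`, then `x² > 4^i δ²`. This majorizes the kernel by a sum of
multiples of indicators of dyadic balls. -/
theorem exists_dyadic_bound {δ x : ℝ} (hδ : 0 < δ) :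
    ∃ j : ℕ, |x| ≤ 2 ^ j * δ ∧ δ / (δ ^ 2 + x ^ 2) ≤ 4 * ((1 / 4) ^ j * δ⁻¹) := by
  have hex : ∃ j : ℕ, |x| ≤ 2 ^ j * δ := by
    obtain ⟨j, hj⟩ := pow_unbounded_of_one_lt (|x| / δ) (one_lt_two (α := ℝ))
    exact ⟨j, ((div_lt_iff₀ hδ).1 hj).le⟩
  classical
  refine ⟨Nat.find hex, Nat.find_spec hex, ?_⟩
  rcases hj : Nat.find hex with _ | i
  · rw [div_le_iff₀ (by positivity)]
    have : 4 * ((1 / 4 : ℝ) ^ 0 * δ⁻¹) * (δ ^ 2 + x ^ 2) = 4 * δ + 4 * (δ⁻¹ * x ^ 2) := by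
      field_simp
    rw [this]
    have : 0 ≤ δ⁻¹ * x ^ 2 := by positivity
    linarith
  · have hlt : 2 ^ i * δ < |x| := by
      have := Nat.find_min hex (m := i) (by omega)
      exact not_le.1 this
    have hsq : (2 ^ i * δ) ^ 2 ≤ x ^ 2 := by
      rw [← sq_abs x]
      exact pow_le_pow_left₀ (by positivity) hlt.le 2
    have h4 : ((2 : ℝ) ^ i) ^ 2 = 4 ^ i := by rw [← pow_mul, mul_comm, pow_mul]; norm_num
    rw [mul_pow, h4] at hsq
    rw [div_le_iff₀ (by positivity)]
    have : 4 * ((1 / 4 : ℝ) ^ (i + 1) * δ⁻¹) * (δ ^ 2 + x ^ 2) =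
        (δ ^ 2 + x ^ 2) / (4 ^ i * δ) := by
      rw [pow_succ, one_div, inv_pow]; field_simp
    rw [this, le_div_iff₀ (by positivity)]
    nlinarith [sq_nonneg δ]

/-- The integral of `g` against an approximate identity with inverse square decay at a point at
which the averages of `g` over shrinking balls tend to zero. -/
theorem tendsto_dyadic_sum {a : ℝ → ℝ} {B : ℝ} (ha0 : ∀ τ, 0 < τ → 0 ≤ a τ)
    (haB : ∀ τ, 0 < τ → a τ ≤ B) (ha : Tendsto a (𝓝[>] 0) (𝓝 0)) :
    Tendsto (fun δ => ∑' j : ℕ, (1 / 2 : ℝ) ^ j * a (2 ^ j * δ)) (𝓝[>] 0) (𝓝 0) := by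
  have h := tendsto_tsum_of_dominated_convergence (𝓕 := 𝓝[>] (0 : ℝ))
    (f := fun δ (j : ℕ) => (1 / 2 : ℝ) ^ j * a (2 ^ j * δ)) (g := fun _ => 0)
    (bound := fun j => (1 / 2 : ℝ) ^ j * B) (summable_geometric_two.mul_right B) ?_ ?_
  · simpa using h
  · intro j
    have h1 : Tendsto (fun δ : ℝ => 2 ^ j * δ) (𝓝[>] 0) (𝓝[>] 0) := by
      refine tendsto_nhdsWithin_iff.2 ⟨?_, ?_⟩
      · have : Tendsto (fun δ : ℝ => 2 ^ j * δ) (𝓝 0) (𝓝 (2 ^ j * 0)) :=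
          (continuous_const.mul continuous_id).tendsto 0
        rw [mul_zero] at this
        exact this.mono_left nhdsWithin_le_nhds
      · filter_upwards [self_mem_nhdsWithin] with δ hδ
        have hδ' : (0 : ℝ) < δ := hδ
        exact mem_Ioi.2 (by positivity)
    simpa using (ha.comp h1).const_mul ((1 / 2 : ℝ) ^ j)
  · filter_upwards [self_mem_nhdsWithin] with δ hδ j
    have hδ' : (0 : ℝ) < δ := hδ
    have h2 : 0 < 2 ^ j * δ := by positivity
    rw [Real.norm_of_nonneg (mul_nonneg (by positivity) (ha0 _ h2))]
    exact mul_le_mul_of_nonneg_left (haB _ h2) (by positivity)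

/-- Since `4^{-j}/δ = 2^{-j} (2^j δ)⁻¹`, the dyadic majorant turns into averages of `g` with
summable weights. The kernel bound is asked only where `g ≠ 0`, as it fails beyond one period. -/
theorem integral_mul_le_dyadic_sum {g Q : ℝ → ℝ} {θ δ C B : ℝ} (hδ : 0 < δ) (hC : 0 ≤ C)
    (hg : Integrable g) (hg0 : ∀ η, 0 ≤ g η)
    (hB : ∀ τ, 0 < τ → τ⁻¹ * ∫ η in Metric.closedBall θ τ, g η ≤ B) (hQ0 : ∀ η, 0 ≤ Q η)
    (hQ : ∀ η, g η ≠ 0 → Q η ≤ C * (δ / (δ ^ 2 + (θ - η) ^ 2)))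
    (hQg : Integrable fun η => Q η * g η) :
    ∫ η, Q η * g η ≤ C * 4 * ∑' j : ℕ, (1 / 2 : ℝ) ^ j *
      ((2 ^ j * δ)⁻¹ * ∫ η in Metric.closedBall θ (2 ^ j * δ), g η) := by
  set S : ℕ → ℝ := fun j => (1 / 2 : ℝ) ^ j *
      ((2 ^ j * δ)⁻¹ * ∫ η in Metric.closedBall θ (2 ^ j * δ), g η) with hS
  have hS0 : ∀ j, 0 ≤ S j := fun j =>
    mul_nonneg (by positivity) (mul_nonneg (by positivity) (integral_nonneg hg0))
  have hSsum : Summable S :=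
    (summable_geometric_two.mul_right B).of_nonneg_of_le hS0 fun j =>
      mul_le_mul_of_nonneg_left (hB _ (by positivity)) (by positivity)
  have hR : 0 ≤ C * 4 * ∑' j, S j := mul_nonneg (by positivity) (tsum_nonneg hS0)
  rw [← ENNReal.ofReal_le_ofReal_iff hR,
    ofReal_integral_eq_lintegral_ofReal hQg (.of_forall fun η => mul_nonneg (hQ0 η) (hg0 η)),
    ← tsum_mul_left, ENNReal.ofReal_tsum_of_nonneg
      (fun j => mul_nonneg (by positivity) (hS0 j)) (hSsum.mul_left _)]
  have hgm : AEMeasurable (fun η => ENNReal.ofReal (g η)) :=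
    hg.aestronglyMeasurable.aemeasurable.ennreal_ofReal
  calc ∫⁻ η, ENNReal.ofReal (Q η * g η)
      ≤ ∫⁻ η, ∑' j : ℕ, ENNReal.ofReal (C * (4 * ((1 / 4) ^ j * δ⁻¹))) *
        (Metric.closedBall θ (2 ^ j * δ)).indicator (fun η => ENNReal.ofReal (g η)) η := by
        refine lintegral_mono fun η => ?_
        by_cases hgη : g η = 0
        · simp [hgη]
        obtain ⟨j, hj, hjb⟩ := exists_dyadic_bound (x := θ - η) hδ
        refine le_trans ?_ (ENNReal.le_tsum j)
        rw [indicator_of_mem (by rwa [Metric.mem_closedBall, dist_comm, Real.dist_eq]),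
          ← ENNReal.ofReal_mul (by positivity)]
        exact ENNReal.ofReal_le_ofReal (mul_le_mul_of_nonneg_right
          ((hQ η hgη).trans (mul_le_mul_of_nonneg_left hjb hC)) (hg0 η))
    _ = ∑' j : ℕ, ENNReal.ofReal (C * 4 * S j) := by
        rw [lintegral_tsum fun j =>
          (hgm.indicator Metric.isClosed_closedBall.measurableSet).const_mul _]
        refine tsum_congr fun j => ?_
        rw [lintegral_const_mul'' _ (hgm.indicator Metric.isClosed_closedBall.measurableSet),
          lintegral_indicator Metric.isClosed_closedBall.measurableSet,
          ← ofReal_integral_eq_lintegral_ofReal hg.integrableOn (.of_forall hg0),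
          ← ENNReal.ofReal_mul (by positivity)]
        congr 1
        have h4 : (1 / 4 : ℝ) ^ j = (1 / 2) ^ j * (2 ^ j)⁻¹ := by
          rw [one_div, one_div, inv_pow, inv_pow, ← mul_inv, ← mul_pow]; norm_num
        simp only [hS]
        rw [h4, mul_inv]
        ring

/-- **Fatou's theorem**: Poisson integrals of integrable functions converge radially almost
everywhere. -/
theorem ae_tendsto_polarPoisson {k : ℝ → ℝ} (hk : Integrable k arcMeasure) :
    ∀ᵐ θ ∂arcMeasure, Tendsto (fun t => polarPoisson t k θ) (𝓝[<] 1) (𝓝 (k θ)) := by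
  set P := Ioc 0 (2 * Real.pi) with hP
  have hkP : IntegrableOn k P := by
    rw [integrable_arcMeasure_iff,
      intervalIntegrable_iff_integrableOn_Ioc_of_le (by positivity)] at hk
    exact hk
  have hf : Integrable (P.indicator k) := hkP.integrable_indicator measurableSet_Ioc
  filter_upwards [ae_arcMeasure_mem, ae_arcMeasure_of_ae
    (IsUnifLocDoublingMeasure.ae_tendsto_average_norm_sub (μ := volume) hf.locallyIntegrable 1)]
    with θ hθ hL
  have hθP : θ ∈ P := Ioo_subset_Ioc_self hθ
  set g : ℝ → ℝ := P.indicator fun η => |k η - k θ| with hg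
  have hg0 : ∀ η, 0 ≤ g η := fun η => indicator_nonneg (fun _ _ => abs_nonneg _) η
  have hgi : Integrable g := by
    refine IntegrableOn.integrable_indicator ?_ measurableSet_Ioc
    exact (hkP.sub (integrableOn_const measure_Ioc_lt_top.ne)).abs
  set a : ℝ → ℝ := fun τ => τ⁻¹ * ∫ η in Metric.closedBall θ τ, g η with ha
  have ha0 : ∀ τ, 0 < τ → 0 ≤ a τ := fun τ hτ =>
    mul_nonneg (by positivity) (integral_nonneg hg0)
  have hat : Tendsto a (𝓝[>] 0) (𝓝 0) := by
    have h1 := hL (l := 𝓝[>] (0 : ℝ)) (fun _ => θ) id tendsto_id (by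
      filter_upwards [self_mem_nhdsWithin] with τ hτ
      have hτ' : (0 : ℝ) < τ := hτ
      simpa using hτ'.le)
    have h2 := h1.const_mul 2
    -- The factor 2 arises because a ball of radius `τ` has length `2τ`, while `a` divides by `τ`.
    rw [mul_zero] at h2
    refine squeeze_zero' ?_ ?_ h2
    · filter_upwards [self_mem_nhdsWithin] with τ hτ using ha0 τ hτ
    · filter_upwards [self_mem_nhdsWithin] with τ hτ
      have hτ' : (0 : ℝ) < τ := hτ
      rw [setAverage_eq, id, Measure.real, Real.volume_closedBall,
        ENNReal.toReal_ofReal (by positivity), smul_eq_mul, ← mul_assoc, mul_inv, ← mul_assoc,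
        mul_inv_cancel₀ two_ne_zero, one_mul]
      refine mul_le_mul_of_nonneg_left ?_ (by positivity)
      refine integral_mono hgi.integrableOn ?_ fun η => ?_
      · exact (hf.integrableOn.sub (integrableOn_const measure_closedBall_lt_top.ne)).norm
      · simp only [hg, indicator_of_mem hθP]
        by_cases h : η ∈ P
        · simp [h, Real.norm_eq_abs]
        · simp [h]
  -- Small radii are covered by convergence, the others by the total integral of `g`.
  obtain ⟨B, hB⟩ : ∃ B, ∀ τ, 0 < τ → a τ ≤ B := by
    have h1 : ∀ᶠ τ in 𝓝[>] (0 : ℝ), a τ < 1 := hat.eventually (gt_mem_nhds one_pos)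
    obtain ⟨τ₀, hτ₀, hsub⟩ := mem_nhdsGT_iff_exists_Ioo_subset.1 h1
    have hτ₀' : (0 : ℝ) < τ₀ := hτ₀
    refine ⟨max 1 (τ₀⁻¹ * ∫ η, g η), fun τ hτ => ?_⟩
    rcases lt_or_ge τ τ₀ with h | h
    · exact (le_of_lt (hsub ⟨hτ, h⟩)).trans (le_max_left _ _)
    · refine le_trans ?_ (le_max_right _ _)
      exact mul_le_mul ((inv_le_inv₀ hτ hτ₀').2 h)
        (setIntegral_le_integral hgi (.of_forall hg0)) (integral_nonneg hg0) (by positivity)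
  set d := min (min θ (2 * Real.pi - θ)) Real.pi with hd
  have hd0 : 0 < d := lt_min (lt_min hθ.1 (sub_pos.2 hθ.2)) Real.pi_pos
  have hdist : ∀ η ∈ P, |θ - η| ≤ 2 * Real.pi - d := by
    intro η hη
    have h1 : d ≤ θ := (min_le_left _ _).trans (min_le_left _ _)
    have h2 : d ≤ 2 * Real.pi - θ := (min_le_left _ _).trans (min_le_right _ _)
    rw [abs_le]
    constructor <;> linarith [hη.1, hη.2]
  set C := 2 / (d / (2 * Real.pi ^ 2)) ^ 2 with hC
  have hC0 : 0 ≤ C := by positivity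
  have hbound : ∀ t, 1 / 2 ≤ t → t < 1 → |polarPoisson t k θ - k θ| ≤
      C * 4 * ∑' j : ℕ, (1 / 2 : ℝ) ^ j * a (2 ^ j * (1 - t)) := by
    intro t ht ht1
    have ht' : |t| < 1 := by rwa [abs_of_nonneg (by linarith)]
    have i1 := integrable_polarKernel_mul ht' hk θ
    have i2 := integrable_polarKernel_mul ht' (integrable_const (k θ)) θ
    have e1 : polarPoisson t k θ - k θ =
        ∫ η, polarKernel t (θ - η) * (k η - k θ) ∂arcMeasure := by
      simp only [mul_sub]
      rw [integral_sub i1 i2, integral_mul_const, integral_polarKernel ht', one_mul]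
      rfl
    have e2 : |polarPoisson t k θ - k θ| ≤
        ∫ η, polarKernel t (θ - η) * |k η - k θ| ∂arcMeasure := by
      rw [e1]
      refine (abs_integral_le_integral_abs).trans_eq (integral_congr_ae (.of_forall fun η => ?_))
      simp only [abs_mul, abs_of_pos (polarKernel_pos ht' _)]
    have hind : (P.indicator fun η => polarKernel t (θ - η) * |k η - k θ|) =
        fun η => polarKernel t (θ - η) * g η := by
      ext η
      by_cases h : η ∈ P <;> simp [hg, h]
    have i3 : Integrable (fun η => polarKernel t (θ - η) * g η) := by
      rw [← hind]
      refine IntegrableOn.integrable_indicator ?_ measurableSet_Ioc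
      have := integrable_polarKernel_mul ht' ((hk.sub (integrable_const (k θ))).abs) θ
      rw [integrable_arcMeasure_iff,
        intervalIntegrable_iff_integrableOn_Ioc_of_le (by positivity)] at this
      exact this
    -- The normalizing factor `1/(2π) ≤ 1` is dropped.
    have e3 : ∫ η, polarKernel t (θ - η) * |k η - k θ| ∂arcMeasure ≤
        ∫ η, polarKernel t (θ - η) * g η := by
      rw [arcMeasure_integral, intervalIntegral.integral_of_le (by positivity),
        ← integral_indicator measurableSet_Ioc, hind]
      refine mul_le_of_le_one_left
        (integral_nonneg fun η => mul_nonneg (polarKernel_pos ht' _).le (hg0 η)) ?_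
      exact inv_le_one_of_one_le₀ (by linarith [Real.pi_gt_three])
    refine (e2.trans e3).trans (integral_mul_le_dyadic_sum (sub_pos.2 ht1) hC0 hgi hg0 hB
      (fun η => (polarKernel_pos ht' _).le) (fun η hη => ?_) i3)
    have hηP : η ∈ P := by
      by_contra h
      exact hη (indicator_of_notMem h _)
    exact polarKernel_le hd0 (min_le_right _ _) ht ht1 (hdist η hηP)
  have hlim := (tendsto_dyadic_sum ha0 hB hat).const_mul (C * 4)
  rw [mul_zero] at hlim
  have hδ : Tendsto (fun t : ℝ => 1 - t) (𝓝[<] 1) (𝓝[>] 0) := by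
    refine tendsto_nhdsWithin_iff.2 ⟨?_, ?_⟩
    · have : Tendsto (fun t : ℝ => 1 - t) (𝓝 1) (𝓝 (1 - 1)) :=
        (continuous_const.sub continuous_id).tendsto 1
      rw [sub_self] at this
      exact this.mono_left nhdsWithin_le_nhds
    · filter_upwards [self_mem_nhdsWithin] with t ht
      exact mem_Ioi.2 (sub_pos.2 ht)
  rw [tendsto_iff_norm_sub_tendsto_zero]
  refine squeeze_zero' (.of_forall fun t => norm_nonneg _) ?_ (hlim.comp hδ)
  filter_upwards [Ioo_mem_nhdsLT (show (1 / 2 : ℝ) < 1 by norm_num)] with t ht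
  exact hbound t ht.1.le ht.2

/-! ### Radial limits of bounded analytic functions. -/

theorem tendsto_polarPoisson_of_eLpNorm {t : ℝ} (ht : |t| < 1) {F : ℝ → ℝ → ℝ} {φ : ℝ → ℝ}
    {l : Filter ℝ} (hF : ∀ᶠ r in l, Continuous (F r)) (hφ : MemLp φ 2 arcMeasure)
    (h : Tendsto (fun r : ℝ => eLpNorm (fun θ => F r θ - φ θ) 2 arcMeasure) l (𝓝 0)) (θ : ℝ) :
    Tendsto (fun r => polarPoisson t (F r) θ) l (𝓝 (polarPoisson t φ θ)) := by
  have hk := continuous_polarKernel ht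
  obtain ⟨C, hC⟩ := (isCompact_Icc (a := (0 : ℝ)) (b := 2 * Real.pi)).exists_bound_of_continuousOn
    (f := fun η => polarKernel t (θ - η)) (by fun_prop)
  have hφi : Integrable φ arcMeasure := hφ.integrable one_le_two
  rw [tendsto_iff_norm_sub_tendsto_zero]
  have h1 : Tendsto (fun r => C * (eLpNorm (fun θ => F r θ - φ θ) 2 arcMeasure).toReal) l (𝓝 0) := by
    simpa using ((ENNReal.tendsto_toReal ENNReal.zero_ne_top).comp h).const_mul C
  refine squeeze_zero' (.of_forall fun _ => norm_nonneg _) ?_ h1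
  filter_upwards [hF, h.eventually (gt_mem_nhds ENNReal.zero_lt_top)] with r hr hfin
  have hi : Integrable (F r) arcMeasure := hr.integrable_arcMeasure
  have hC0 : 0 ≤ C := (norm_nonneg _).trans (hC 0 ⟨le_rfl, by positivity⟩)
  have e1 : polarPoisson t (F r) θ - polarPoisson t φ θ =
      ∫ η, polarKernel t (θ - η) * (F r η - φ η) ∂arcMeasure := by
    simp only [mul_sub]
    rw [integral_sub (integrable_polarKernel_mul ht hi θ) (integrable_polarKernel_mul ht hφi θ)]
    rfl
  have hd : Integrable (fun η => F r η - φ η) arcMeasure := hi.sub hφi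
  calc ‖polarPoisson t (F r) θ - polarPoisson t φ θ‖
      ≤ ∫ η, C * ‖F r η - φ η‖ ∂arcMeasure := by
        rw [e1]
        refine norm_integral_le_of_norm_le (hd.norm.const_mul C) ?_
        filter_upwards [ae_arcMeasure_mem] with η hη
        rw [norm_mul]
        exact mul_le_mul_of_nonneg_right (hC η (Ioo_subset_Icc_self hη)) (norm_nonneg _)
    _ = C * (eLpNorm (fun θ => F r θ - φ θ) 1 arcMeasure).toReal := by
        rw [integral_const_mul, integral_norm_eq_lintegral_enorm hd.aestronglyMeasurable,
          eLpNorm_one_eq_lintegral_enorm]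
    _ ≤ _ := by
        refine mul_le_mul_of_nonneg_left (ENNReal.toReal_mono hfin.ne ?_) hC0
        exact eLpNorm_le_eLpNorm_of_exponent_le one_le_two hd.aestronglyMeasurable

theorem tendsto_mul_nhdsLT_one (t : ℝ) : Tendsto (fun s : ℝ => t * s) (𝓝[<] 1) (𝓝 t) := by
  have : Tendsto (fun s : ℝ => t * s) (𝓝 1) (𝓝 (t * 1)) :=
    (continuous_const.mul continuous_id).tendsto 1
  rw [mul_one] at this
  exact this.mono_left nhdsWithin_le_nhds

theorem ContinuousOn.tendsto_circleMap {E : Type*} [TopologicalSpace E] {u : ℂ → E}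
    (hu : ContinuousOn u disc) {t : ℝ} (h0 : 0 ≤ t) (h1 : t < 1) (θ : ℝ) :
    Tendsto (fun s : ℝ => u (circleMap 0 (t * s) θ)) (𝓝[<] 1) (𝓝 (u (circleMap 0 t θ))) := by
  have hc : Continuous fun r : ℝ => circleMap 0 r θ := by unfold circleMap; fun_prop
  have := hu.continuousAt (Metric.isOpen_ball.mem_nhds (circleMap_mem_disc h0 h1 θ))
  exact this.tendsto.comp ((hc.tendsto t).comp (tendsto_mul_nhdsLT_one t))

theorem eventually_nhdsLT_one : ∀ᶠ r in 𝓝[<] (1 : ℝ), r ∈ Ioo (0 : ℝ) 1 :=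
  Ioo_mem_nhdsLT zero_lt_one

theorem ae_exists_tendsto_re {h : ℂ → ℂ} (hh : DifferentiableOn ℂ h disc)
    (hb : ∀ z ∈ disc, ‖h z‖ ≤ 1) :
    ∀ᵐ θ ∂arcMeasure, ∃ x : ℝ,
      Tendsto (fun r : ℝ => (h (circleMap 0 r θ)).re) (𝓝[<] 1) (𝓝 x) := by
  -- Adding 1 makes the harmonic function nonnegative, with values in `[0, 2]`; it is then Poisson
  -- dominated, with equality.
  set u : ℂ → ℝ := fun z => (h z + 1).re with hu
  have habs : ∀ z ∈ disc, |(h z).re| ≤ 1 := fun z hz => (Complex.abs_re_le_norm _).trans (hb z hz)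
  have hcont : ContinuousOn u disc :=
    Complex.continuous_re.comp_continuousOn (hh.continuousOn.add continuousOn_const)
  have hP : ∀ ρ s θ : ℝ, 0 ≤ ρ → ρ < s → s < 1 →
      polarPoisson (ρ / s) (fun η => u (circleMap 0 s η)) θ = u (circleMap 0 ρ θ) := by
    intro ρ s θ h0 h1 h2
    refine polarPoisson_of_harmonic (by rwa [abs_of_nonneg h0]) (fun z hz => ?_) θ
    exact ((hh.analyticOnNhd_closedBall_of_disc h2 z hz).add analyticAt_const).harmonicAt_re
  have hdom : PoissonDominated u :=
    { continuousOn := hcont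
      nonneg := fun z hz => by
        have := (abs_le.1 (habs z hz)).1
        simp only [hu, Complex.add_re, Complex.one_re]
        linarith
      le_polarPoisson := fun ρ s θ h0 h1 h2 => (hP ρ s θ h0 h1 h2).ge }
  obtain ⟨φ, hφ, hL, -⟩ := hdom.exists_boundary ⟨4, fun r hr => by
    have hc := (hcont.continuous_circleMap_of_disc hr.1.le hr.2).pow 2
    calc ∫ θ, u (circleMap 0 r θ) ^ 2 ∂arcMeasure ≤ ∫ θ, (4 : ℝ) ∂arcMeasure := by
          refine integral_mono hc.integrable_arcMeasure (integrable_const _) fun θ => ?_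
          have := abs_le.1 (habs _ (circleMap_mem_disc hr.1.le hr.2 θ))
          simp only [hu, Complex.add_re, Complex.one_re]
          nlinarith
      _ = 4 := by simp⟩
  -- Apply the Poisson formula to radii `t r < r`, whose ratio stays `t`, and let `r → 1`.
  have hrep : ∀ t ∈ Ioo (0 : ℝ) 1, ∀ θ, u (circleMap 0 t θ) = polarPoisson t φ θ := by
    intro t ht θ
    refine tendsto_nhds_unique (hcont.tendsto_circleMap ht.1.le ht.2 θ) ?_
    refine (tendsto_polarPoisson_of_eLpNorm (by rw [abs_of_pos ht.1]; exact ht.2) ?_ hφ hL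
      θ).congr' ?_
    · filter_upwards [eventually_nhdsLT_one] with r hr
      exact hcont.continuous_circleMap_of_disc hr.1.le hr.2
    · filter_upwards [eventually_nhdsLT_one] with r hr
      have := hP (t * r) r θ (mul_nonneg ht.1.le hr.1.le)
        (mul_lt_of_lt_one_left hr.1 ht.2) hr.2
      rwa [mul_div_cancel_right₀ _ hr.1.ne'] at this
  filter_upwards [ae_tendsto_polarPoisson (hφ.integrable one_le_two)] with θ hθ
  refine ⟨φ θ - 1, (hθ.sub_const 1).congr' ?_⟩
  filter_upwards [eventually_nhdsLT_one] with t ht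
  rw [← hrep t ht θ]
  simp [hu]

/-- Bounded analytic functions have radial limits almost everywhere. -/
theorem ae_exists_tendsto_of_bounded {h : ℂ → ℂ} (hh : DifferentiableOn ℂ h disc)
    (hb : ∀ z ∈ disc, ‖h z‖ ≤ 1) :
    ∀ᵐ θ ∂arcMeasure, ∃ w : ℂ,
      Tendsto (fun r : ℝ => h (circleMap 0 r θ)) (𝓝[<] 1) (𝓝 w) := by
  filter_upwards [ae_exists_tendsto_re hh hb, ae_exists_tendsto_re (h := fun z => -Complex.I * h z)
    (hh.const_mul _) fun z hz => by simpa using hb z hz] with θ ⟨x, hx⟩ ⟨y, hy⟩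
  refine ⟨x + y * Complex.I, ?_⟩
  have := (Complex.continuous_ofReal.tendsto x).comp hx |>.add
    (((Complex.continuous_ofReal.tendsto y).comp hy).mul_const Complex.I)
  refine this.congr fun r => ?_
  apply Complex.ext <;> simp

/-- Countably many translates of one period cover the line. -/
theorem ae_of_ae_arcMeasure {q : ℝ → Prop} (hq : ∀ (n : ℤ) θ, q (θ + n * (2 * Real.pi)) → q θ)
    (h : ∀ᵐ θ ∂arcMeasure, q θ) : ∀ᵐ θ, q θ := by
  rw [ae_arcMeasure_iff, ae_restrict_iff' measurableSet_Ioc] at h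
  have h1 : ∀ n : ℤ, ∀ᵐ θ : ℝ, θ + n * (2 * Real.pi) ∈ Ioc 0 (2 * Real.pi) →
      q (θ + n * (2 * Real.pi)) := fun n =>
    (measurePreserving_add_right volume ((n : ℝ) * (2 * Real.pi))).quasiMeasurePreserving.ae h
  filter_upwards [ae_all_iff.2 h1] with θ hθ
  obtain ⟨n, hn, -⟩ := existsUnique_add_zsmul_mem_Ioc Real.two_pi_pos θ 0
  rw [zsmul_eq_mul, zero_add] at hn
  exact hq n θ (hθ n hn)

/-! ### Outer functions. -/

section Outer

variable {p : ℝ}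

/-- The real part of the Herglotz integral is the Poisson integral. -/
theorem norm_outer_eq {F : ℂ → ℂ} {c : ℂ} {k : ℂ → ℝ} (hc : ‖c‖ = 1) (hk : CircleIntegrable k 0 1)
    (hF : ∀ z ∈ disc, F z =
      c * Complex.exp (Real.circleAverage (fun ζ => herglotzRieszKernel 0 z ζ * (k ζ : ℂ)) 0 1))
    {t : ℝ} (h0 : 0 ≤ t) (h1 : t < 1) (θ : ℝ) :
    ‖F (circleMap 0 t θ)‖ = Real.exp (polarPoisson t (fun η => k (circleMap 0 1 η)) θ) := by
  have hz := circleMap_mem_disc h0 h1 θ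
  rw [hF _ hz, norm_mul, hc, one_mul, Complex.norm_exp]
  have h := re_circleAverage_herglotzRieszKernel_smul hk hz
  rw [← poissonKernel_eq_re_herglotzRieszKernel, circleAverage_poissonKernel_eq one_pos,
    div_one] at h
  simp only [smul_eq_mul] at h
  rw [h]

theorem differentiableOn_outer {F : ℂ → ℂ} {c : ℂ} {k : ℂ → ℝ} (hk : CircleIntegrable k 0 1)
    (hF : ∀ z ∈ disc, F z =
      c * Complex.exp (Real.circleAverage (fun ζ => herglotzRieszKernel 0 z ζ * (k ζ : ℂ)) 0 1)) :
    DifferentiableOn ℂ F disc := by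
  have hk' : CircleIntegrable (fun ζ => (k ζ : ℂ)) 0 1 := by
    simp only [CircleIntegrable, intervalIntegrable_iff] at hk ⊢
    exact Complex.ofRealCLM.integrable_comp hk
  have h := differentiableOn_circleAverage_herglotzRieszKernel_smul hk'
  simp only [smul_eq_mul] at h
  exact (h.cexp.const_mul c).congr hF

theorem integrable_prod_polarKernel_mul {t : ℝ} (ht : |t| < 1) {u : ℝ → ℝ}
    (hu : Integrable u arcMeasure) :
    Integrable (fun x : ℝ × ℝ => polarKernel t (x.1 - x.2) * u x.2)
      (arcMeasure.prod arcMeasure) := by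
  have hk := continuous_polarKernel ht
  have hK : IsCompact (Icc (0 : ℝ) (2 * Real.pi) ×ˢ Icc (0 : ℝ) (2 * Real.pi)) :=
    isCompact_Icc.prod isCompact_Icc
  obtain ⟨C, hC⟩ := hK.exists_bound_of_continuousOn
    (f := fun x : ℝ × ℝ => polarKernel t (x.1 - x.2)) (by fun_prop)
  refine (hu.comp_snd arcMeasure).bdd_mul (c := C) (by fun_prop) ?_
  have h := ae_arcMeasure_mem
  filter_upwards [Measure.quasiMeasurePreserving_fst.ae h, Measure.quasiMeasurePreserving_snd.ae h]
    with x h1 h2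
  exact hC x ⟨Ioo_subset_Icc_self h1, Ioo_subset_Icc_self h2⟩

theorem integrable_polarPoisson {t : ℝ} (ht : |t| < 1) {u : ℝ → ℝ}
    (hu : Integrable u arcMeasure) : Integrable (polarPoisson t u) arcMeasure :=
  (integrable_prod_polarKernel_mul ht hu).integral_prod_left

theorem integral_polarPoisson_of_integrable {t : ℝ} (ht : |t| < 1) {u : ℝ → ℝ}
    (hu : Integrable u arcMeasure) :
    ∫ θ, polarPoisson t u θ ∂arcMeasure = ∫ θ, u θ ∂arcMeasure := by
  simp only [polarPoisson]
  rw [integral_integral_swap (integrable_prod_polarKernel_mul ht hu)]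
  simp only [integral_mul_const, integral_polarKernel' ht, one_mul]

theorem exists_seq_nhdsLT_one : ∃ r : ℕ → ℝ, (∀ n, r n ∈ Ioo (0 : ℝ) 1) ∧
    Tendsto r atTop (𝓝[<] 1) := by
  obtain ⟨a, -, ha, ha1⟩ := exists_seq_strictMono_tendsto' (zero_lt_one' ℝ)
  exact ⟨a, ha, tendsto_nhdsWithin_iff.2 ⟨ha1, .of_forall fun n => (ha n).2⟩⟩

/-- The outer part of a Hardy function is a Hardy function. -/
theorem MemHardy.memHardy_outer (hp : 0 < p) {f I F : ℂ → ℂ} (hf : MemHardy p f)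
    (h : IsInnerOuterFactorization f I F) : MemHardy p F := by
  obtain ⟨hI, ⟨c, k, hc, hk, hF⟩, hfIF⟩ := h
  obtain ⟨C, hC⟩ := hf.2
  set κ : ℝ → ℝ := fun η => k (circleMap 0 1 η) with hκ
  have hκi : Integrable κ arcMeasure := circleIntegrable_iff_arcMeasure.1 hk
  obtain ⟨r, hr, hr1⟩ := exists_seq_nhdsLT_one
  -- Radially `|f| = |I| |F|` tends to `e^κ` almost everywhere, so Fatou's lemma transfers the bound
  -- on the means of `f`.
  have hexp : Integrable (fun θ => Real.exp (p * κ θ)) arcMeasure := by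
    refine (integrable_and_integral_le_of_tendsto_ae (μ := arcMeasure)
      (h := fun n θ => ‖f (circleMap 0 (r n) θ)‖ ^ p) (c := fun _ => C) (C := C)
      (fun n => (continuous_norm_rpow_circleMap hf.1 hp (hr n).1.le (hr n).2).integrable_arcMeasure)
      (fun n => .of_forall fun θ => by simp only [Pi.zero_apply]; positivity)
      (.of_forall fun n => (meanPow_eq p f (r n)).symm.trans_le (hC _ (hr n)))
      tendsto_const_nhds ?_).1
    filter_upwards [ae_tendsto_polarPoisson hκi, ae_arcMeasure_of_ae hI.2.2]
      with θ h1 ⟨w, hw, h2⟩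
    have h3 := ((h2.comp hr1).norm.mul ((Real.continuous_exp.tendsto _).comp
      (h1.comp hr1))).rpow_const (p := p) (Or.inr hp.le)
    rw [hw, one_mul, ← Real.exp_mul, mul_comm] at h3
    refine h3.congr fun n => ?_
    have hz := circleMap_mem_disc (hr n).1.le (hr n).2 θ
    rw [hfIF _ hz, norm_mul, norm_outer_eq hc hk hF (hr n).1.le (hr n).2]
    rfl
  have hFd := differentiableOn_outer hk hF
  refine ⟨hFd, ∫ θ, Real.exp (p * κ θ) ∂arcMeasure, fun t ht => ?_⟩
  have ht' : |t| < 1 := by rw [abs_of_pos ht.1]; exact ht.2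
  rw [meanPow_eq, ← integral_polarPoisson_of_integrable ht' hexp]
  refine integral_mono (continuous_norm_rpow_circleMap hFd hp ht.1.le ht.2).integrable_arcMeasure
    (integrable_polarPoisson ht' hexp) fun θ => ?_
  simp only
  rw [norm_outer_eq hc hk hF ht.1.le ht.2, ← Real.exp_mul, mul_comm, ← polarPoisson_const_mul]
  exact exp_polarPoisson_le ht' (hκi.const_mul p) hexp θ

theorem aNormPow_congr {α : ℝ} {f g : ℂ → ℂ} (h : ∀ z ∈ disc, ‖f z‖ = ‖g z‖) :
    aNormPow α p f = aNormPow α p g := by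
  have hm : ∀ r ∈ Ioo (0 : ℝ) 1, meanPow p f r = meanPow p g r := by
    intro r hr
    rw [meanPow_eq, meanPow_eq]
    refine integral_congr_ae (.of_forall fun θ => ?_)
    simp only [h _ (circleMap_mem_disc hr.1.le hr.2 θ)]
  rw [aNormPow, aNormPow, h 0 (by simp [disc])]
  congr 1
  refine setLIntegral_congr_fun measurableSet_Ioo fun r hr => ?_
  have : deriv (meanPow p f) r = deriv (meanPow p g) r := by
    refine Filter.EventuallyEq.deriv_eq ?_
    filter_upwards [Ioo_mem_nhds hr.1 hr.2] with s hs using hm s hs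
  simp only [this]

/-- The outer part of a function in `A^p_α` is in `A^p_α`. -/
theorem MemA.memA_outer {α : ℝ} (hα : α < 1) (hp : 0 < p) {f I F : ℂ → ℂ} (hf : MemA α p f)
    (hf0 : ∃ z ∈ disc, f z ≠ 0) (h : IsInnerOuterFactorization f I F) : MemA α p F := by
  have hF := (hf.memHardy hα hp hf0).memHardy_outer hp h
  refine ⟨hF.1, ?_⟩
  by_cases hn : InnerNontrivial I
  · exact (aNorm_lt_of_isHardyQuotient hα hp hf hf0 h.1 hn ⟨hF, h.2.2⟩).trans hf.2
  -- A constant inner function is unimodular, its value being its own radial limit.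
  · obtain ⟨c, hc⟩ := not_not.1 hn
    obtain ⟨θ, w, hw, hlim⟩ := h.1.2.2.exists
    have hcw : c = w := by
      refine tendsto_nhds_unique (tendsto_const_nhds.congr' ?_) hlim
      filter_upwards [eventually_nhdsLT_one] with r hr
      rw [hc _ (circleMap_mem_disc hr.1.le hr.2 θ)]
    have hnorm : ∀ z ∈ disc, ‖F z‖ = ‖f z‖ := by
      intro z hz
      rw [h.2.2 z hz, hc z hz, norm_mul, hcw, hw, one_mul]
    rw [aNorm, aNormPow_congr hnorm]
    exact hf.2

end Outer

/-! ### Inner-outer factorization. -/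

section Factorization

variable {p : ℝ}

theorem log_rpow_norm (q : ℝ) {w : ℂ} (hw : w ≠ 0) : Real.log (‖w‖ ^ q) = q * Real.log ‖w‖ :=
  Real.log_rpow (norm_pos_iff.2 hw) q

/-- `-log|f|` alone has no lower bound; adding a power makes Fatou's lemma available. -/
theorem rpow_sub_log_nonneg {q : ℝ} (hq : 0 < q) (w : ℂ) : 0 ≤ ‖w‖ ^ q - q * Real.log ‖w‖ := by
  by_cases hw : w = 0
  · simp [hw, Real.zero_rpow hq.ne']
  · rw [← log_rpow_norm q hw]
    have := Real.log_le_sub_one_of_pos (Real.rpow_pos_of_pos (norm_pos_iff.2 hw) q)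
    linarith

theorem ae_ne_zero_circleMap {f : ℂ → ℂ} (hf : DifferentiableOn ℂ f disc)
    (hf0 : ∃ z ∈ disc, f z ≠ 0) {r : ℝ} (hr : r ∈ Ioo (0 : ℝ) 1) :
    ∀ᵐ θ ∂arcMeasure, f (circleMap 0 r θ) ≠ 0 := by
  filter_upwards [ae_arcMeasure_circleMap_notMem (countable_zeros hf hf0) hr.1.ne'] with θ h h0
  exact h ⟨circleMap_mem_disc hr.1.le hr.2 θ, h0⟩

theorem log_norm_mul_le_polarPoisson {f : ℂ → ℂ} (hf : DifferentiableOn ℂ f disc) {t r : ℝ}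
    (ht0 : 0 ≤ t) (ht1 : t < 1) (hr : r ∈ Ioo (0 : ℝ) 1) (θ : ℝ)
    (hne : f (circleMap 0 (t * r) θ) ≠ 0) :
    Real.log ‖f (circleMap 0 (t * r) θ)‖ ≤
      polarPoisson t (fun η => Real.log ‖f (circleMap 0 r η)‖) θ := by
  have h := log_norm_le_polarPoisson (R := r) (ρ := t * r)
    (by rw [abs_of_nonneg (mul_nonneg ht0 hr.1.le)]; exact mul_lt_of_lt_one_left hr.1 ht1)
    (hf.analyticOnNhd_closedBall_of_disc hr.2) θ hne
  rwa [mul_div_cancel_right₀ _ hr.1.ne'] at h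

/-- Poisson–Jensen integrated over the circle. It bounds the logarithmic means from below by the one
at a fixed radius. -/
theorem integral_log_norm_le {f : ℂ → ℂ} (hf : DifferentiableOn ℂ f disc)
    (hf0 : ∃ z ∈ disc, f z ≠ 0) {ρ r : ℝ} (hρ : 0 < ρ) (hρr : ρ < r) (hr : r < 1) :
    ∫ θ, Real.log ‖f (circleMap 0 ρ θ)‖ ∂arcMeasure ≤
      ∫ θ, Real.log ‖f (circleMap 0 r θ)‖ ∂arcMeasure := by
  have hr0 : 0 < r := hρ.trans hρr
  have ht1 : ρ / r < 1 := (div_lt_one hr0).2 hρr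
  have ht : |ρ / r| < 1 := by rwa [abs_of_pos (by positivity)]
  have hi := integrable_log_norm_circleMap hr0 (hf.analyticOnNhd_closedBall_of_disc hr)
  rw [← integral_polarPoisson_of_integrable ht hi]
  refine integral_mono_ae (integrable_log_norm_circleMap hρ
    (hf.analyticOnNhd_closedBall_of_disc (hρr.trans hr))) (integrable_polarPoisson ht hi) ?_
  filter_upwards [ae_ne_zero_circleMap hf hf0 ⟨hρ, hρr.trans hr⟩] with θ hθ
  have h := log_norm_mul_le_polarPoisson hf (t := ρ / r) (r := r) (by positivity) ht1 ⟨hr0, hr⟩ θ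
  rw [div_mul_cancel₀ _ hr0.ne'] at h
  exact h hθ

/-- Boundary data of a nonzero Hardy function: the boundary values of `|f|` have an integrable
logarithm, whose Poisson integral dominates `log |f|`. -/
theorem MemHardy.exists_log_boundary (hp : 0 < p) {f : ℂ → ℂ} (hf : MemHardy p f)
    (hf0 : ∃ z ∈ disc, f z ≠ 0) :
    ∃ (κ : ℝ → ℝ) (r : ℕ → ℝ), (∀ n, r n ∈ Ioo (0 : ℝ) 1) ∧ Tendsto r atTop (𝓝[<] 1) ∧
      Integrable κ arcMeasure ∧
      (∀ᵐ θ ∂arcMeasure, Tendsto (fun n => Real.log ‖f (circleMap 0 (r n) θ)‖) atTop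
        (𝓝 (κ θ))) ∧
      (∀ᵐ θ ∂arcMeasure, Tendsto (fun n => ‖f (circleMap 0 (r n) θ)‖) atTop
        (𝓝 (Real.exp (κ θ)))) ∧
      ∀ t θ, 0 ≤ t → t < 1 → ‖f (circleMap 0 t θ)‖ ≤ Real.exp (polarPoisson t κ θ) := by
  set q := p / 2 with hq
  have hq0 : 0 < q := half_pos hp
  obtain ⟨φ, hφ, hL, -⟩ := hf.exists_boundary hp
  obtain ⟨C, hC⟩ := hf.2
  have hcq : ∀ r ∈ Ioo (0 : ℝ) 1, Continuous fun θ => ‖f (circleMap 0 r θ)‖ ^ q :=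
    fun r hr => continuous_norm_rpow_circleMap hf.1 hq0 hr.1.le hr.2
  obtain ⟨r, hr, hr1, hae⟩ := exists_seq_tendsto_ae_of_eLpNorm hcq hφ hL
  have hφi : Integrable φ arcMeasure := hφ.integrable one_le_two
  set h : ℕ → ℝ → ℝ := fun n θ =>
    ‖f (circleMap 0 (r n) θ)‖ ^ q - q * Real.log ‖f (circleMap 0 (r n) θ)‖ with hh
  have hLi : ∀ n, Integrable (fun θ => Real.log ‖f (circleMap 0 (r n) θ)‖) arcMeasure := fun n =>
    integrable_log_norm_circleMap (hr n).1 (hf.1.analyticOnNhd_closedBall_of_disc (hr n).2)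
  have hui : ∀ n, Integrable (fun θ => ‖f (circleMap 0 (r n) θ)‖ ^ q) arcMeasure := fun n =>
    (hcq _ (hr n)).integrable_arcMeasure
  have hhi : ∀ n, Integrable (h n) arcMeasure := fun n => (hui n).sub ((hLi n).const_mul q)
  have hh0 : ∀ n θ, 0 ≤ h n θ := fun n θ => rpow_sub_log_nonneg hq0 _
  -- The power is bounded through `x ≤ 1 + x²`, the logarithm through its mean at the fixed radius
  -- `1/2`.
  set B := 1 + C - q * ∫ θ, Real.log ‖f (circleMap 0 (1 / 2) θ)‖ ∂arcMeasure with hB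
  have hbound : ∀ᶠ n in atTop, ∫ θ, h n θ ∂arcMeasure ≤ B := by
    filter_upwards [hr1.eventually (Ioo_mem_nhdsLT (show (1 / 2 : ℝ) < 1 by norm_num))] with n hn
    simp only [hh]
    rw [integral_sub (hui n) ((hLi n).const_mul q), integral_const_mul]
    have h1 := integral_log_norm_le hf.1 hf0 (by norm_num) hn.1 hn.2
    have h2 : ∫ θ, ‖f (circleMap 0 (r n) θ)‖ ^ q ∂arcMeasure ≤ 1 + C := by
      have h3 := hC (r n) (hr n)
      rw [meanPow_eq_sq] at h3
      have h4 : Integrable (fun θ => (‖f (circleMap 0 (r n) θ)‖ ^ q) ^ 2) arcMeasure :=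
        ((hcq _ (hr n)).pow 2).integrable_arcMeasure
      calc ∫ θ, ‖f (circleMap 0 (r n) θ)‖ ^ q ∂arcMeasure
          ≤ ∫ θ, (1 + (‖f (circleMap 0 (r n) θ)‖ ^ q) ^ 2) ∂arcMeasure := by
            refine integral_mono (hui n) ((integrable_const _).add h4) fun θ => ?_
            simp only
            nlinarith [sq_nonneg (‖f (circleMap 0 (r n) θ)‖ ^ q - 1),
              sq_nonneg (‖f (circleMap 0 (r n) θ)‖ ^ q)]
        _ = 1 + ∫ θ, (‖f (circleMap 0 (r n) θ)‖ ^ q) ^ 2 ∂arcMeasure := by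
            rw [integral_add (integrable_const _) h4]; simp
        _ ≤ 1 + C := by linarith
    have h5 := mul_le_mul_of_nonneg_left h1 hq0.le
    linarith
  have hne : ∀ᵐ θ ∂arcMeasure, ∀ n, f (circleMap 0 (r n) θ) ≠ 0 :=
    ae_all_iff.2 fun n => ae_ne_zero_circleMap hf.1 hf0 (hr n)
  -- Where `φ = 0`, `h n` tends to infinity; finiteness of the integral of the lower limit confines
  -- this to a null set.
  have hpos : ∀ᵐ θ ∂arcMeasure, 0 < φ θ := by
    have hfin : ∫⁻ θ, liminf (fun n => ENNReal.ofReal (h n θ)) atTop ∂arcMeasure < ∞ := by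
      calc _ ≤ liminf (fun n => ∫⁻ θ, ENNReal.ofReal (h n θ) ∂arcMeasure) atTop :=
            lintegral_liminf_le' fun n => (hhi n).aestronglyMeasurable.aemeasurable.ennreal_ofReal
        _ ≤ liminf (fun _ : ℕ => ENNReal.ofReal B) atTop := by
            refine liminf_le_liminf (hbound.mono fun n hn => ?_)
            rw [← ofReal_integral_eq_lintegral_ofReal (hhi n) (.of_forall (hh0 n))]
            exact ENNReal.ofReal_le_ofReal hn
        _ < ∞ := by rw [liminf_const]; exact ENNReal.ofReal_lt_top
    have hm : Measurable fun θ => liminf (fun n => ENNReal.ofReal (h n θ)) atTop := by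
      refine .liminf fun n => Measurable.ennreal_ofReal ?_
      have hfc := hf.1.continuousOn.continuous_circleMap_of_disc (hr n).1.le (hr n).2
      exact (hcq _ (hr n)).measurable.sub
        ((Real.measurable_log.comp hfc.norm.measurable).const_mul q)
    filter_upwards [ae_lt_top hm hfin.ne, hae, hne] with θ h1 h2 h3
    have h4 : 0 ≤ φ θ := ge_of_tendsto' h2 fun n => by positivity
    refine lt_of_le_of_ne h4 fun h5 => h1.ne ?_
    have h6 : Tendsto (fun n => ‖f (circleMap 0 (r n) θ)‖ ^ q) atTop (𝓝[>] 0) := by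
      refine tendsto_nhdsWithin_iff.2 ⟨by rw [h5]; exact h2, .of_forall fun n => ?_⟩
      exact Real.rpow_pos_of_pos (norm_pos_iff.2 (h3 n)) q
    have h7 : Tendsto (fun n => h n θ) atTop atTop := by
      refine tendsto_atTop_mono (fun n => ?_)
        (tendsto_neg_atBot_atTop.comp (Real.tendsto_log_nhdsGT_zero.comp h6))
      simp only [hh, Function.comp_apply]
      rw [log_rpow_norm q (h3 n)]
      have : 0 ≤ ‖f (circleMap 0 (r n) θ)‖ ^ q := by positivity
      linarith
    exact (ENNReal.tendsto_ofReal_nhds_top.2 h7).liminf_eq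
  have hlogae : ∀ᵐ θ ∂arcMeasure, Tendsto (fun n => Real.log ‖f (circleMap 0 (r n) θ)‖) atTop
      (𝓝 (q⁻¹ * Real.log (φ θ))) := by
    filter_upwards [hpos, hae, hne] with θ h1 h2 h3
    refine ((h2.log h1.ne').const_mul q⁻¹).congr fun n => ?_
    rw [log_rpow_norm q (h3 n), inv_mul_cancel_left₀ hq0.ne']
  have hhae : ∀ᵐ θ ∂arcMeasure, Tendsto (fun n => h n θ) atTop
      (𝓝 (φ θ - q * (q⁻¹ * Real.log (φ θ)))) := by
    filter_upwards [hae, hlogae] with θ h1 h2 using h1.sub (h2.const_mul q)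
  have hlim := integrable_and_integral_le_of_tendsto_ae hhi (fun n => .of_forall (hh0 n)) hbound
    tendsto_const_nhds hhae
  set κ : ℝ → ℝ := fun θ => q⁻¹ * Real.log (φ θ) with hκ
  have hκi : Integrable κ arcMeasure := by
    refine ((hφi.sub hlim.1).const_mul q⁻¹).congr (.of_forall fun θ => ?_)
    simp only [hκ, Pi.sub_apply, sub_sub_cancel]
    rw [inv_mul_cancel_left₀ hq0.ne']
  refine ⟨κ, r, hr, hr1, hκi, hlogae, ?_, fun t θ₀ ht0 ht1 => ?_⟩
  · filter_upwards [hlogae, hne] with θ h1 h2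
    refine ((Real.continuous_exp.tendsto _).comp h1).congr fun n => ?_
    exact Real.exp_log (norm_pos_iff.2 (h2 n))
  · by_cases hz : f (circleMap 0 t θ₀) = 0
    · rw [hz, norm_zero]; positivity
    have ht : |t| < 1 := by rwa [abs_of_nonneg ht0]
    have hfc := (hf.1.continuousOn.tendsto_circleMap ht0 ht1 θ₀).comp hr1
    have hev : ∀ᶠ n in atTop, f (circleMap 0 (t * r n) θ₀) ≠ 0 :=
      hfc.eventually (isOpen_ne.mem_nhds hz)
    have hPφ := (tendsto_polarPoisson_of_eLpNorm ht
      (by filter_upwards [eventually_nhdsLT_one] with s hs using hcq s hs) hφ hL θ₀).comp hr1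
    have hlogc : Tendsto (fun n => Real.log ‖f (circleMap 0 (t * r n) θ₀)‖) atTop
        (𝓝 (Real.log ‖f (circleMap 0 t θ₀)‖)) := hfc.norm.log (norm_ne_zero_iff.2 hz)
    -- Fatou's lemma against the kernel, with Poisson–Jensen bounding the integrals, gives `P_t φ -
    -- q P_t κ ≤ P_t φ - q log|f|`; the term `P_t φ` cancels thanks to the `L²` convergence.
    have hfatou := (integrable_and_integral_le_of_tendsto_ae
      (h := fun n η => polarKernel t (θ₀ - η) * h n η)
      (g := fun η => polarKernel t (θ₀ - η) * (φ η - q * κ η))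
      (c := fun n => polarPoisson t (fun η => ‖f (circleMap 0 (r n) η)‖ ^ q) θ₀ -
        q * Real.log ‖f (circleMap 0 (t * r n) θ₀)‖)
      (fun n => integrable_polarKernel_mul ht (hhi n) θ₀)
      (fun n => .of_forall fun η => mul_nonneg (polarKernel_pos ht _).le (hh0 n η)) ?_
      (hPφ.sub (hlogc.const_mul q)) ?_).2
    · have e1 : ∫ η, polarKernel t (θ₀ - η) * (φ η - q * κ η) ∂arcMeasure =
          polarPoisson t φ θ₀ - q * polarPoisson t κ θ₀ := by
        rw [← polarPoisson_const_mul]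
        simp only [mul_sub]
        exact integral_sub (integrable_polarKernel_mul ht hφi θ₀)
          (integrable_polarKernel_mul ht (hκi.const_mul q) θ₀)
      rw [e1] at hfatou
      have h1 : Real.log ‖f (circleMap 0 t θ₀)‖ ≤ polarPoisson t κ θ₀ :=
        le_of_mul_le_mul_left (by linarith) hq0
      exact (Real.log_le_iff_le_exp (norm_pos_iff.2 hz)).1 h1
    · filter_upwards [hev] with n hn
      have e1 : ∫ η, polarKernel t (θ₀ - η) * h n η ∂arcMeasure =
          polarPoisson t (fun η => ‖f (circleMap 0 (r n) η)‖ ^ q) θ₀ -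
            q * polarPoisson t (fun η => Real.log ‖f (circleMap 0 (r n) η)‖) θ₀ := by
        rw [← polarPoisson_const_mul]
        simp only [hh, mul_sub]
        exact integral_sub (integrable_polarKernel_mul ht (hui n) θ₀)
          (integrable_polarKernel_mul ht ((hLi n).const_mul q) θ₀)
      rw [e1]
      have := mul_le_mul_of_nonneg_left
        (log_norm_mul_le_polarPoisson hf.1 ht0 ht1 (hr n) θ₀ hn) hq0.le
      linarith
    · filter_upwards [hhae] with η hη using hη.const_mul _

/-- Inner-outer factorization in the Hardy space. -/
theorem MemHardy.exists_isInnerOuterFactorization (hp : 0 < p) {f : ℂ → ℂ} (hf : MemHardy p f)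
    (hf0 : ∃ z ∈ disc, f z ≠ 0) : ∃ I F : ℂ → ℂ, IsInnerOuterFactorization f I F := by
  obtain ⟨κ, r, hr, hr1, hκ, hlog, habs, hle⟩ := hf.exists_log_boundary hp hf0
  -- `κ` is a function of the angle, whereas an outer function needs boundary data on the circle.
  -- Where the limit fails to exist `k` has a junk value, on a null set.
  set k : ℂ → ℝ := fun ζ => limUnder atTop fun n => Real.log ‖f (r n * ζ)‖ with hk
  have hmul : ∀ s θ : ℝ, (s : ℂ) * circleMap 0 1 θ = circleMap 0 s θ := by
    intro s θ; simp [circleMap]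
  have hkκ : κ =ᵐ[arcMeasure] fun η => k (circleMap 0 1 η) := by
    filter_upwards [hlog] with θ h1
    simp only [hk, hmul]
    exact h1.limUnder_eq.symm
  have hki : CircleIntegrable k 0 1 := circleIntegrable_iff_arcMeasure.2 (hκ.congr hkκ)
  set F : ℂ → ℂ := fun z => 1 * Complex.exp
    (Real.circleAverage (fun ζ => herglotzRieszKernel 0 z ζ * (k ζ : ℂ)) 0 1) with hF
  have hFd : DifferentiableOn ℂ F disc := differentiableOn_outer hki fun z _ => rfl
  have hF0 : ∀ z, F z ≠ 0 := fun z => mul_ne_zero one_ne_zero (Complex.exp_ne_zero _)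
  have hFn : ∀ t θ, 0 ≤ t → t < 1 →
      ‖F (circleMap 0 t θ)‖ = Real.exp (polarPoisson t κ θ) := by
    intro t θ h0 h1
    rw [norm_outer_eq norm_one hki (fun z _ => rfl) h0 h1, polarPoisson_congr_ae hkκ]
  have hId : DifferentiableOn ℂ (fun z => f z / F z) disc := hf.1.div hFd fun z _ => hF0 z
  have hIb : ∀ z ∈ disc, ‖f z / F z‖ ≤ 1 := by
    intro z hz
    have hz1 : ‖z‖ < 1 := by simpa [disc] using hz
    have hzc : circleMap 0 ‖z‖ z.arg = z := by
      rw [circleMap, zero_add, Complex.norm_mul_exp_arg_mul_I]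
    have h1 := hle ‖z‖ z.arg (norm_nonneg z) hz1
    rw [← hFn _ _ (norm_nonneg z) hz1, hzc] at h1
    rw [norm_div]
    exact div_le_one_of_le₀ h1 (norm_nonneg _)
  refine ⟨fun z => f z / F z, F, ⟨hId, hIb, ?_⟩, ⟨1, k, norm_one, hki, fun z _ => rfl⟩,
    fun z _ => (div_mul_cancel₀ _ (hF0 z)).symm⟩
  refine ae_of_ae_arcMeasure (fun n θ hθ => ?_) ?_
  · have hper : ∀ s : ℝ, circleMap 0 s (θ + n * (2 * Real.pi)) = circleMap 0 s θ := fun s =>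
      (periodic_circleMap 0 s).int_mul n θ
    simpa only [hper] using hθ
  · filter_upwards [ae_exists_tendsto_of_bounded hId hIb, habs, ae_tendsto_polarPoisson hκ]
      with θ ⟨w, hw⟩ h1 h2
    refine ⟨w, ?_, hw⟩
    have h3 : Tendsto (fun n => ‖F (circleMap 0 (r n) θ)‖) atTop (𝓝 (Real.exp (κ θ))) := by
      refine ((Real.continuous_exp.tendsto _).comp (h2.comp hr1)).congr fun n => ?_
      rw [hFn _ _ (hr n).1.le (hr n).2]
      rfl
    -- The radial limit `w` exists, so its modulus can be read off along the sequence `r n`.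
    have h4 := h1.div h3 (Real.exp_ne_zero _)
    rw [div_self (Real.exp_ne_zero _)] at h4
    refine tendsto_nhds_unique (hw.comp hr1).norm (h4.congr fun n => ?_)
    simp only [Function.comp_apply, Pi.div_apply, norm_div]

end Factorization

theorem theorem1p9 (α p : ℝ) (hα0 : 0 < α) (hα1 : α < 1) (hp : 0 < p)
    (f : ℂ → ℂ) (hf : MemA α p f) (hf0 : ∃ z ∈ disc, f z ≠ 0) :
    (∀ I g : ℂ → ℂ, IsInner I → InnerNontrivial I → IsHardyQuotient p f I g →
      aNorm α p g < aNorm α p f) ∧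
    (∃ I F : ℂ → ℂ, IsInnerOuterFactorization f I F) ∧
    (∀ I F : ℂ → ℂ, IsInnerOuterFactorization f I F → MemA α p F) :=
  ⟨fun _ _ hI hn hg => aNorm_lt_of_isHardyQuotient hα1 hp hf hf0 hI hn hg,
    (hf.memHardy hα1 hp hf0).exists_isInnerOuterFactorization hp hf0,
    fun _ _ h => hf.memA_outer hα1 hp hf0 h⟩
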